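/- Let $M^2$ be a (connected) Riemann surface and let $f,\hat f:M^2\to\mathbb{R}^3$ be non-flat conformal minimal immersions, given by Weierstrass data $(g,q)$ and $(\hat g,\hat q)$ respectively. That is, $g$ is a meromorphic function and $q$ a ($\mathbb{C}$-valued) holomorphic quadratic differential on $M$, and there is a holomorphic differential $\omega$ on $M$ with $2\omega\,dg=q$ and $$df = 2\,\mathrm{Re}(g\omega)\,i+\mathrm{Re}((1-g^2)\omega)\,j+\mathrm{Im}((1+g^2)\omega)\,k,$$ where $(i,j,k)$ is the standard basis of $\mathbb{R}^3$; likewise for $\hat f$ and $(\hat g,\hat q)$. Then $(f,\hat f)$ is, up to translation, a Darboux pair if and only if there is $t\in\mathbb{R}\setminus\{0\}$ such that $$dg\,d\hat g=t\,(\hat g-g)^2\,q\quad\text{and}\quad \hat q=q.$$ Here $M$ orients both surfaces. Two immersions $f,\hat f:M^2\to\mathbb{R}^3$ form a Ribaucour pair if, for each $p\in M$, $f(p)\neq\hat f(p)$, there is an oriented $2$-sphere (or plane) that has first order contact, with matching orientation, with $f$ at $f(p)$ and with $\hat f$ at $\hat f(p)$, and the shape operators of $f$ and $\hat f$ at $p$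 commute. A Ribaucour pair is a Darboux pair if, in addition, the induced metrics are conformally equivalent. "Up to translation" means that $(f,\hat f+c)$ is a Darboux pair for some $c\in\mathbb{R}^3$. -/

import Mathlib

open scoped Manifold ContDiff

namespace MinimalDarboux

noncomputable section

/-- Euclidean 3-space; the coordinates `0, 1, 2` belong to the basis vectors `i, j, k`. -/
abbrev R3 := EuclideanSpace ℝ (Fin 3)

/-- The cross product of Euclidean 3-space. -/
def cross (x y : R3) : R3 := WithLp.toLp 2 (crossProduct (WithLp.ofLp x) (WithLp.ofLp y))

section Surfaces

variable {M : Type*} [TopologicalSpace M] [ChartedSpace ℂ M]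

/-- The (real) differential `df_p : T_pM → ℝ³`. The tangent space of a Riemann surface at `p` is
`ℂ` (through the preferred holomorphic chart at `p`), for the real and for the complex
structure alike. -/
def diff (f : M → R3) (p : M) : ℂ →L[ℝ] R3 :=
  mfderiv 𝓘(ℝ, ℂ) 𝓘(ℝ, R3) f p

/-- The (complex) differential `dg_p : T_pM → ℂ` of a complex function. -/
def cdiff (g : M → ℂ) (p : M) : ℂ →L[ℂ] ℂ :=
  mfderiv 𝓘(ℂ, ℂ) 𝓘(ℂ, ℂ) g p

/-- The Gauss map of an immersion of a Riemann surface, determined by the orientations of the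
surface (`1, I` is a positive basis of `T_pM = ℂ`) and of `ℝ³`. -/
def gaussMap (f : M → R3) (p : M) : R3 :=
  ‖cross (diff f p 1) (diff f p Complex.I)‖⁻¹ • cross (diff f p 1) (diff f p Complex.I)

/-- The shape operator `A` of an immersion, `dn = - df ∘ A`: as `dn` takes values in the range of
the injective map `df`, `A` is obtained by applying any left inverse of `df` to `-dn`. -/
def shapeOperator (f : M → R3) (p : M) : ℂ →ₗ[ℝ] ℂ :=
  -((diff f p).toLinearMap.leftInverse ∘ₗ (diff (gaussMap f) p).toLinearMap)

/-- Smooth conformal immersion of a Riemann surface: each differential is a nonzero multiple of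
a linear isometry. -/
def IsConformalImmersion (f : M → R3) : Prop :=
  ContMDiff 𝓘(ℝ, ℂ) 𝓘(ℝ, R3) ∞ f ∧ ∀ p, IsConformalMap (diff f p)

/-- Conformal minimal immersion: the mean curvature (half the trace of the shape operator)
vanishes. -/
def IsConformalMinimalImmersion (f : M → R3) : Prop :=
  IsConformalImmersion f ∧ ∀ p, LinearMap.trace ℝ ℂ (shapeOperator f p) = 0

/-- A surface is flat if its Gauss curvature vanishes identically. -/
def IsFlat (f : M → R3) : Prop :=
  ∀ p, LinearMap.det (shapeOperator f p) = 0

/-- Oriented 2-spheres of the conformally compactified Euclidean space: the zero sets of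
`a |x|² - 2 ⟨v, x⟩ + b`, where `|v|² - a b = 1`. For `a ≠ 0` this is the round sphere with center
`a⁻¹ v` and radius `|a|⁻¹`; for `a = 0` it is the plane (a sphere through `∞`) with
unit normal `v`. -/
structure OrientedSphere where
  a : ℝ
  v : R3
  b : ℝ
  norm_sq : ‖v‖ ^ 2 - a * b = 1

/-- The points of a sphere. -/
def OrientedSphere.points (S : OrientedSphere) : Set R3 :=
  {x | S.a * ‖x‖ ^ 2 - 2 * inner ℝ S.v x + S.b = 0}

/-- The unit normal of a sphere at its point `x`. -/
def OrientedSphere.normal (S : OrientedSphere) (x : R3) : R3 := S.v - S.a • x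

/-- First order contact of an oriented sphere with the oriented immersed surface `f` at `p`:
the sphere passes through `f p` and has the same (oriented) tangent plane there. -/
def OrientedSphere.Touches (S : OrientedSphere) (f : M → R3) (p : M) : Prop :=
  f p ∈ S.points ∧ S.normal (f p) = gaussMap f p

/-- Ribaucour pair: the two surfaces envelop a congruence of oriented spheres, touching each of
them at two distinct points, and their shape operators commute. -/
def IsRibaucourPair (f fh : M → R3) : Prop :=
  (∀ p, f p ≠ fh p) ∧
  (∀ p, ∃ S : OrientedSphere, S.Touches f p ∧ S.Touches fh p) ∧
  (∀ p, Commute (shapeOperator f p : Module.End ℝ ℂ) (shapeOperator fh p))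

/-- Darboux pair: a Ribaucour pair with conformally equivalent induced metrics. -/
def IsDarbouxPair (f fh : M → R3) : Prop :=
  IsRibaucourPair f fh ∧
  ∃ lam : M → ℝ, ∀ p, 0 < lam p ∧
    ∀ v w : ℂ, inner ℝ (diff fh p v) (diff fh p w) = lam p * inner ℝ (diff f p v) (diff f p w)

/-- Meromorphic functions on a Riemann surface, encoded as complex functions in normal form:
in charts, the function is near every point the quotient of holomorphic functions, with removable
singularities removed and with value `0` at the poles. The poles are exactly the points where it
is not complex differentiable. -/
def IsMeromorphicFunction (g : M → ℂ) : Prop :=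
  ∀ p : M, MeromorphicNFAt (g ∘ (chartAt ℂ p).symm) (chartAt ℂ p p)

/-- `p` is not a pole of the meromorphic function `g`. -/
def IsHolomorphicAt (g : M → ℂ) (p : M) : Prop :=
  MDifferentiableAt 𝓘(ℂ, ℂ) 𝓘(ℂ, ℂ) g p

variable (M) in
/-- Holomorphic differentials: complex linear forms on the tangent spaces, such that
in a chart with coordinate `z` the coefficient of `dz` is holomorphic. -/
structure HolomorphicDifferential where
  form : (p : M) → TangentSpace 𝓘(ℂ, ℂ) p →ₗ[ℂ] ℂ
  holomorphic : ∀ p₀ : M, DifferentiableOn ℂ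
    (fun z : ℂ => form ((chartAt ℂ p₀).symm z)
      (mfderiv 𝓘(ℂ, ℂ) 𝓘(ℂ, ℂ) (chartAt ℂ p₀).symm z (1 : ℂ)))
    (chartAt ℂ p₀).target

variable (M) in
/-- Holomorphic quadratic differentials: complex quadratic forms on the tangent spaces, such that
in a chart with coordinate `z` the coefficient of `dz²` is holomorphic. -/
structure HolomorphicQuadraticDifferential where
  form : (p : M) → QuadraticForm ℂ (TangentSpace 𝓘(ℂ, ℂ) p)
  holomorphic : ∀ p₀ : M, DifferentiableOn ℂ
    (fun z : ℂ => form ((chartAt ℂ p₀).symm z)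
      (mfderiv 𝓘(ℂ, ℂ) 𝓘(ℂ, ℂ) (chartAt ℂ p₀).symm z (1 : ℂ)))
    (chartAt ℂ p₀).target

/-- `f` is given by the Weierstrass data `(g, q)`: with a holomorphic differential `η`
such that `2 η dg = q`,
`df = 2 Re(g η) i + Re((1 - g²) η) j + Im((1 + g²) η) k`,
as identities away from the (isolated) poles of `g`. -/
def HasWeierstrassData (f : M → R3) (g : M → ℂ) (q : HolomorphicQuadraticDifferential M) : Prop :=
  IsMeromorphicFunction g ∧
  ∃ η : HolomorphicDifferential M, ∀ p, IsHolomorphicAt g p → ∀ v : ℂ,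
    q.form p v = 2 * η.form p v * cdiff g p v ∧
    diff f p v = !₂[2 * (g p * η.form p v).re,
                    ((1 - g p ^ 2) * η.form p v).re,
                    ((1 + g p ^ 2) * η.form p v).im]

/-- The holomorphic Riccati equation `dg dĝ = t (ĝ - g)² q` with spectral parameter `t`, an
equation of meromorphic quadratic differentials, that is, an identity away from the poles. -/
def HolomorphicRiccati (t : ℝ) (g gh : M → ℂ) (q : HolomorphicQuadraticDifferential M) : Prop :=
  ∀ p, IsHolomorphicAt g p → IsHolomorphicAt gh p → ∀ v : ℂ,
    cdiff g p v * cdiff gh p v = (t : ℂ) * (gh p - g p) ^ 2 * q.form p v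

end Surfaces

end

end MinimalDarboux

/-!
Where `g` and `ĝ` have no poles, `df = Re (φ(g) ω)` with the null vector
`φ(g) = (2g, 1 - g², -i(1 + g²))`, and the normals `n`, `n̂` are the points of the unit sphere with
stereographic parameters `g`, `ĝ`. Where moreover `g ≠ ĝ`, put `u = (ĝ - g)⁻¹` and
`X = u (g + ĝ, 1 - gĝ, -i(1 + gĝ))`. This complex vector has `X · X = 1`, is orthogonal to `φ(g)` and
`φ(ĝ)`, its real part `midVec g ĝ` is a positive multiple of `n - n̂` (`gaussVec_sub_gaussVec`), and
`dX = φ(ĝ) u² dg - φ(g) u² dĝ` (`hasFDerivAt_midVec`).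

Both surfaces are conformal for the same complex structure, and their shape operators are given by
the quadratic differentials `q`, `q̂` (`HasWeierstrassData.exists_shapeOperator_eq`), so everything
rests on the contact condition, which says that `n - n̂ = a F` for the chord `F = f̂ - f`
(and `F ⊥ n` where `a = 0`).

* For a Ribaucour pair this gives `F = s Re X` with a real function `s`, so
  `Re (φ(ĝ) (ω̂ - s u² dg) - φ(g) (ω - s u² dĝ)) = ds Re X`. As the forms on the left are of type
  `(1, 0)`, all coefficients vanish (`eq_zero_of_weierstrassMap_sub`): `s` is constant,
  `ω = s u² dĝ` and `ω̂ = s u² dg`, that is, `q = q̂` and `dg dĝ = (2s)⁻¹ (ĝ - g)² q`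
  (`ratio_of_parallel`, `IsRibaucourPair.exists_holomorphicRiccati`).
* Conversely, the Riccati equation with `q = q̂` makes `F - (2t)⁻¹ Re X` constant, and a translation
  removes the constant (`HolomorphicRiccati.exists_sub_eq`). Then `t |F|² (n - n̂) = F` and
  `|F|² ≥ (4t²)⁻¹`, from which the touching spheres are read off (`isDarbouxPair_of_sub_eq`).

The poles of `g` and `ĝ`, the zeros of `q` and the points with `g = ĝ` form a discrete set, unless
`g` and `ĝ` coincide, which non-flatness excludes. All conclusions extend over this set by
continuity, and local constants are global because punctured discs are connected
(`eventually_codiscrete_eq_const`). The generic points are handled by the filter `codiscrete M`.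
-/

namespace MinimalDarboux

open Filter Topology

/-! ### Charts of a Riemann surface -/

section Charts

variable {M : Type*} [TopologicalSpace M] [ChartedSpace ℂ M]

variable (M) in
theorem isManifold_real [IsManifold 𝓘(ℂ, ℂ) ω M] : IsManifold 𝓘(ℝ, ℂ) ∞ M := by
  have : IsManifold 𝓘(ℂ, ℂ) ∞ M := .of_le (n := ω) le_top
  refine isManifold_of_contDiffOn 𝓘(ℝ, ℂ) ∞ M fun e e' he he' => ?_
  have h := (contDiffGroupoid ∞ 𝓘(ℂ, ℂ)).compatible he he'
  rw [contDiffGroupoid, mem_groupoid_of_pregroupoid] at h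
  exact h.1.restrict_scalars ℝ

/-- The vector of the preferred chart at `(chartAt ℂ p₀).symm z` that represents the coordinate
vector `∂/∂z` of the chart at `p₀`. -/
noncomputable def coordVec (p₀ : M) (z : ℂ) : ℂ :=
  mfderiv 𝓘(ℂ, ℂ) 𝓘(ℂ, ℂ) (chartAt ℂ p₀).symm z (1 : ℂ)

theorem hasMFDerivAt_iff_chart {𝕜 : Type*} [NontriviallyNormedField 𝕜] [NormedSpace 𝕜 ℂ]
    {E : Type*} [NormedAddCommGroup E] [NormedSpace 𝕜 E] {h : M → E} {p : M} {L : ℂ →L[𝕜] E} :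
    HasMFDerivAt 𝓘(𝕜, ℂ) 𝓘(𝕜, E) h p L ↔
      HasFDerivAt (h ∘ (chartAt ℂ p).symm) L (chartAt ℂ p p) := by
  have key : HasFDerivWithinAt (writtenInExtChartAt 𝓘(𝕜, ℂ) 𝓘(𝕜, E) p h) L
      (Set.range 𝓘(𝕜, ℂ)) (extChartAt 𝓘(𝕜, ℂ) p p) ↔
      HasFDerivAt (h ∘ (chartAt ℂ p).symm) L (chartAt ℂ p p) := by
    simp only [writtenInExtChartAt, mfld_simps, hasFDerivWithinAt_univ]
    rfl
  refine ⟨fun H => key.1 H.2, fun H => ⟨?_, key.2 H⟩⟩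
  have h1 := H.continuousAt.comp ((chartAt ℂ p).continuousAt (mem_chart_source ℂ p))
  refine h1.congr ?_
  filter_upwards [(chartAt ℂ p).open_source.mem_nhds (mem_chart_source ℂ p)] with x hx
  simp [(chartAt ℂ p).left_inv hx]

theorem coordVec_self (p : M) : coordVec p (chartAt ℂ p p) = 1 := by
  have h0 := mem_chart_target ℂ p
  have hs : (chartAt ℂ p).symm (chartAt ℂ p p) = p := (chartAt ℂ p).left_inv (mem_chart_source ℂ p)
  have h : HasMFDerivAt 𝓘(ℂ, ℂ) 𝓘(ℂ, ℂ) (chartAt ℂ p).symm (chartAt ℂ p p)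
      (ContinuousLinearMap.id ℂ ℂ) := by
    refine ⟨(chartAt ℂ p).continuousAt_symm h0, ?_⟩
    have : HasFDerivAt (chartAt ℂ p ∘ (chartAt ℂ p).symm) (ContinuousLinearMap.id ℂ ℂ)
        (chartAt ℂ p p) := by
      refine (hasFDerivAt_id _).congr_of_eventuallyEq ?_
      filter_upwards [(chartAt ℂ p).open_target.mem_nhds h0] with z hz
      simp [(chartAt ℂ p).right_inv hz]
    simp only [writtenInExtChartAt, mfld_simps, hs]
    exact this.hasFDerivWithinAt
  rw [coordVec, h.mfderiv]
  rfl

variable [IsManifold 𝓘(ℂ, ℂ) ω M]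

theorem hasMFDerivAt_chart_symm (p₀ : M) {z : ℂ} (hz : z ∈ (chartAt ℂ p₀).target) :
    HasMFDerivAt 𝓘(ℂ, ℂ) 𝓘(ℂ, ℂ) (chartAt ℂ p₀).symm z
      (ContinuousLinearMap.mul ℂ ℂ (coordVec p₀ z)) := by
  have : IsManifold 𝓘(ℂ, ℂ) 1 M := .of_le (n := ω) le_top
  have h := (mdifferentiableAt_atlas_symm (I := 𝓘(ℂ, ℂ)) (chart_mem_atlas ℂ p₀) hz).hasMFDerivAt
  refine h.congr_mfderiv ?_
  refine ContinuousLinearMap.ext_ring ?_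
  exact (mul_one (coordVec p₀ z)).symm

theorem hasMFDerivAt_real_chart_symm (p₀ : M) {z : ℂ} (hz : z ∈ (chartAt ℂ p₀).target) :
    HasMFDerivAt 𝓘(ℝ, ℂ) 𝓘(ℝ, ℂ) (chartAt ℂ p₀).symm z
      (ContinuousLinearMap.mul ℝ ℂ (coordVec p₀ z)) := by
  have h := hasMFDerivAt_chart_symm p₀ hz
  refine ⟨h.1, ?_⟩
  have h2 := h.2.restrictScalars ℝ
  convert! h2 using 1

theorem isHolomorphicAt_chart_symm {g : M → ℂ} (p₀ : M) {z : ℂ} (hz : z ∈ (chartAt ℂ p₀).target) :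
    IsHolomorphicAt g ((chartAt ℂ p₀).symm z) ↔
      DifferentiableAt ℂ (g ∘ (chartAt ℂ p₀).symm) z := by
  have : IsManifold 𝓘(ℂ, ℂ) 1 M := .of_le (n := ω) le_top
  rw [← mdifferentiableAt_iff_differentiableAt]
  constructor
  · intro h
    exact h.comp _ (hasMFDerivAt_chart_symm p₀ hz).mdifferentiableAt
  · intro h
    have hs := (chartAt ℂ p₀).map_target hz
    have h2 : MDifferentiableAt 𝓘(ℂ, ℂ) 𝓘(ℂ, ℂ) (chartAt ℂ p₀) ((chartAt ℂ p₀).symm z) :=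
      mdifferentiableAt_atlas (chart_mem_atlas ℂ p₀) hs
    have h3 : MDifferentiableAt 𝓘(ℂ, ℂ) 𝓘(ℂ, ℂ) (g ∘ (chartAt ℂ p₀).symm)
      ((chartAt ℂ p₀) ((chartAt ℂ p₀).symm z)) := by rwa [(chartAt ℂ p₀).right_inv hz]
    refine (h3.comp _ h2).congr_of_eventuallyEq ?_
    filter_upwards [(chartAt ℂ p₀).open_source.mem_nhds hs] with x hx
    simp [(chartAt ℂ p₀).left_inv hx]

theorem hasDerivAt_comp_chart_symm {g : M → ℂ} (p₀ : M) {z : ℂ}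
    (hz : z ∈ (chartAt ℂ p₀).target) (hg : IsHolomorphicAt g ((chartAt ℂ p₀).symm z)) :
    HasDerivAt (g ∘ (chartAt ℂ p₀).symm)
      (cdiff g ((chartAt ℂ p₀).symm z) (coordVec p₀ z)) z := by
  have h : HasFDerivAt (g ∘ (chartAt ℂ p₀).symm) ((cdiff g ((chartAt ℂ p₀).symm z)).comp
      (ContinuousLinearMap.mul ℂ ℂ (coordVec p₀ z))) z :=
    (HasMFDerivAt.comp z hg.hasMFDerivAt (hasMFDerivAt_chart_symm p₀ hz)).hasFDerivAt
  simpa using h.hasDerivAt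

theorem hasFDerivAt_comp_chart_symm {E : Type*} [NormedAddCommGroup E] [NormedSpace ℝ E]
    {h : M → E} (p₀ : M) {z : ℂ} (hz : z ∈ (chartAt ℂ p₀).target) {L : ℂ →L[ℝ] E}
    (hh : HasMFDerivAt 𝓘(ℝ, ℂ) 𝓘(ℝ, E) h ((chartAt ℂ p₀).symm z) L) :
    HasFDerivAt (h ∘ (chartAt ℂ p₀).symm)
      (L.comp (ContinuousLinearMap.mul ℝ ℂ (coordVec p₀ z))) z := by
  exact (HasMFDerivAt.comp z hh (hasMFDerivAt_real_chart_symm p₀ hz)).hasFDerivAt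

theorem coordVec_ne_zero (p₀ : M) {z : ℂ} (hz : z ∈ (chartAt ℂ p₀).target) :
    coordVec p₀ z ≠ 0 := by
  have : IsManifold 𝓘(ℂ, ℂ) 1 M := .of_le (n := ω) le_top
  intro h0
  have hs := (chartAt ℂ p₀).map_target hz
  have h2 : MDifferentiableAt 𝓘(ℂ, ℂ) 𝓘(ℂ, ℂ) (chartAt ℂ p₀) ((chartAt ℂ p₀).symm z) :=
    mdifferentiableAt_atlas (chart_mem_atlas ℂ p₀) hs
  have h := hasDerivAt_comp_chart_symm p₀ hz h2
  have h' : HasDerivAt (chartAt ℂ p₀ ∘ (chartAt ℂ p₀).symm) 1 z := by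
    refine (hasDerivAt_id z).congr_of_eventuallyEq ?_
    filter_upwards [(chartAt ℂ p₀).open_target.mem_nhds hz] with w hw
    simp [(chartAt ℂ p₀).right_inv hw]
  have := h.unique h'
  simp [h0] at this

end Charts

/-! ### Properties that hold off a discrete set -/

section Codiscrete

theorem eventually_codiscrete_iff {X : Type*} [TopologicalSpace X] {P : X → Prop} :
    (∀ᶠ x in codiscrete X, P x) ↔ ∀ p, ∀ᶠ x in 𝓝[≠] p, P x := by
  simp [Filter.Eventually, mem_codiscrete]

theorem eventually_codiscrete_nhds {X : Type*} [TopologicalSpace X] [T1Space X] {P : X → Prop}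
    (h : ∀ᶠ x in codiscrete X, P x) : ∀ᶠ x in codiscrete X, ∀ᶠ y in 𝓝 x, P y := by
  rw [eventually_codiscrete_iff] at h ⊢
  intro p
  filter_upwards [eventually_eventually_nhdsWithin.2 (h p), self_mem_nhdsWithin] with x hx hxp
  rwa [isOpen_compl_singleton.nhdsWithin_eq hxp] at hx

/-- A property that locally holds either generically or generically not does so globally on a
connected space without isolated points. -/
theorem eventually_codiscrete_or_not {X : Type*} [TopologicalSpace X] [T1Space X]
    [ConnectedSpace X] [∀ x : X, (𝓝[≠] x).NeBot] {P : X → Prop}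
    (h : ∀ p, (∀ᶠ x in 𝓝[≠] p, P x) ∨ ∀ᶠ x in 𝓝[≠] p, ¬ P x) :
    (∀ᶠ x in codiscrete X, P x) ∨ ∀ᶠ x in codiscrete X, ¬ P x := by
  have hopen : ∀ Q : X → Prop, IsOpen {p | ∀ᶠ x in 𝓝[≠] p, Q x} := by
    intro Q
    rw [isOpen_iff_mem_nhds]
    intro p hp
    have h1 : ∀ᶠ y in 𝓝[≠] p, ∀ᶠ x in 𝓝[≠] y, Q x := by
      filter_upwards [eventually_eventually_nhdsWithin.2 hp, self_mem_nhdsWithin] with x hx hxp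
      rw [isOpen_compl_singleton.nhdsWithin_eq hxp] at hx
      exact hx.filter_mono nhdsWithin_le_nhds
    rw [eventually_nhdsWithin_iff] at h1
    filter_upwards [h1] with y hy
    by_cases hyp : y = p
    · rwa [hyp]
    · exact hy hyp
  have hclopen : IsClopen {p | ∀ᶠ x in 𝓝[≠] p, P x} := by
    refine ⟨⟨?_⟩, hopen P⟩
    convert hopen fun x => ¬ P x using 1
    ext p
    refine ⟨fun hp => (h p).resolve_left hp, fun hp hp' => ?_⟩
    have hp₁ : ∀ᶠ x in 𝓝[≠] p, ¬ P x := hp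
    have hp₂ : ∀ᶠ x in 𝓝[≠] p, P x := hp'
    obtain ⟨x, hx, hx'⟩ := (hp₁.and hp₂).exists
    exact hx hx'
  simp only [eventually_codiscrete_iff]
  rcases isClopen_iff.1 hclopen with h0 | h1
  · exact .inr fun p => (h p).resolve_left fun hp => (Set.eq_empty_iff_forall_notMem.1 h0) p hp
  · exact .inl fun p => (Set.eq_univ_iff_forall.1 h1) p

variable {M : Type*} [TopologicalSpace M] [ChartedSpace ℂ M]

theorem tendsto_chart_nhdsNE (p : M) :
    Tendsto (chartAt ℂ p) (𝓝[≠] p) (𝓝[≠] (chartAt ℂ p p)) := by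
  have hs := mem_chart_source ℂ p
  refine tendsto_nhdsWithin_iff.2
    ⟨((chartAt ℂ p).continuousAt hs).tendsto.mono_left nhdsWithin_le_nhds, ?_⟩
  filter_upwards [self_mem_nhdsWithin,
    nhdsWithin_le_nhds ((chartAt ℂ p).open_source.mem_nhds hs)] with x hx hxs h
  exact hx ((chartAt ℂ p).injOn hxs hs h)

theorem tendsto_chart_symm_nhdsNE (p : M) :
    Tendsto (chartAt ℂ p).symm (𝓝[≠] (chartAt ℂ p p)) (𝓝[≠] p) := by
  have hs := mem_chart_target ℂ p
  have hp : (chartAt ℂ p).symm (chartAt ℂ p p) = p := (chartAt ℂ p).left_inv (mem_chart_source ℂ p)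
  have hc := ((chartAt ℂ p).continuousAt_symm hs).tendsto
  rw [hp] at hc
  refine tendsto_nhdsWithin_iff.2 ⟨hc.mono_left nhdsWithin_le_nhds, ?_⟩
  filter_upwards [self_mem_nhdsWithin,
    nhdsWithin_le_nhds ((chartAt ℂ p).open_target.mem_nhds hs)] with x hx hxs h
  apply hx
  rw [Set.mem_singleton_iff] at h ⊢
  rw [← (chartAt ℂ p).right_inv hxs, h]

theorem eventually_nhdsNE_iff_chart {P : M → Prop} (p : M) :
    (∀ᶠ x in 𝓝[≠] p, P x) ↔
      ∀ᶠ z in 𝓝[≠] (chartAt ℂ p p), P ((chartAt ℂ p).symm z) := by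
  refine ⟨fun h => (tendsto_chart_symm_nhdsNE p).eventually h, fun h => ?_⟩
  filter_upwards [(tendsto_chart_nhdsNE p).eventually h, nhdsWithin_le_nhds
    ((chartAt ℂ p).open_source.mem_nhds (mem_chart_source ℂ p))] with x hx hxs
  rwa [(chartAt ℂ p).left_inv hxs] at hx

theorem nhdsNE_neBot (p : M) : (𝓝[≠] p).NeBot :=
  (tendsto_chart_symm_nhdsNE p).neBot

/-- A punctured disc is a translate of the image of a half-plane under the exponential map. -/
theorem isPreconnected_ball_diff_singleton (z : ℂ) (r : ℝ) :
    IsPreconnected (Metric.ball z r \ {z}) := by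
  rcases le_or_gt r 0 with hr | hr
  · rw [Metric.ball_eq_empty.2 hr]
    simpa using isPreconnected_empty
  have h : Metric.ball z r \ {z} = (fun w => z + Complex.exp w) '' {w | w.re < Real.log r} := by
    ext x
    simp only [Set.mem_sdiff, Metric.mem_ball, Set.mem_singleton_iff, Set.mem_image,
      Set.mem_ofPred_eq]
    constructor
    · rintro ⟨h1, h2⟩
      have h3 : x - z ≠ 0 := sub_ne_zero.2 h2
      refine ⟨Complex.log (x - z), ?_, by rw [Complex.exp_log h3]; ring⟩
      rw [Complex.log_re]
      exact Real.log_lt_log (norm_pos_iff.2 h3) (by rwa [dist_eq_norm] at h1)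
    · rintro ⟨w, hw, rfl⟩
      refine ⟨?_, by simp [Complex.exp_ne_zero]⟩
      rw [dist_eq_norm, add_sub_cancel_left, Complex.norm_exp]
      exact (Real.lt_log_iff_exp_lt hr).1 hw
  rw [h]
  exact (convex_halfSpace_re_lt _).isPreconnected.image _ (by fun_prop)

variable [T2Space M] [ConnectedSpace M] [IsManifold 𝓘(ℂ, ℂ) ω M]

/-- A map with vanishing differential off a discrete set is constant off a discrete set: near each
point it is constant on a punctured disc. -/
theorem eventually_codiscrete_eq_const {E : Type*} [NormedAddCommGroup E] [NormedSpace ℝ E]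
    {h : M → E} (hh : ∀ᶠ x in codiscrete M, HasMFDerivAt 𝓘(ℝ, ℂ) 𝓘(ℝ, E) h x (0 : ℂ →L[ℝ] E)) :
    ∃ c, ∀ᶠ x in codiscrete M, h x = c := by
  have key : ∀ p : M, ∃ c, ∀ᶠ x in 𝓝[≠] p, h x = c := by
    intro p
    have h1 := (eventually_nhdsNE_iff_chart p).1 (eventually_codiscrete_iff.1 hh p)
    have h2 := h1.and
      (nhdsWithin_le_nhds ((chartAt ℂ p).open_target.mem_nhds (mem_chart_target ℂ p)))
    obtain ⟨r, hr, hball⟩ := Metric.eventually_nhds_iff_ball.1 (eventually_nhdsWithin_iff.1 h2)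
    have hd : ∀ z ∈ Metric.ball (chartAt ℂ p p) r \ {chartAt ℂ p p},
        HasFDerivAt (h ∘ (chartAt ℂ p).symm) (0 : ℂ →L[ℝ] E) z := by
      intro z hz
      obtain ⟨hz1, hz2⟩ := hball z hz.1 hz.2
      simpa using hasFDerivAt_comp_chart_symm p hz2 hz1
    have hconst : ∀ {x y}, x ∈ Metric.ball (chartAt ℂ p p) r \ {chartAt ℂ p p} →
        y ∈ Metric.ball (chartAt ℂ p p) r \ {chartAt ℂ p p} →
        (h ∘ (chartAt ℂ p).symm) x = (h ∘ (chartAt ℂ p).symm) y :=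
      (Metric.isOpen_ball.sdiff isClosed_singleton).is_const_of_fderiv_eq_zero
      (isPreconnected_ball_diff_singleton (chartAt ℂ p p) r)
      (fun z hz => (hd z hz).differentiableAt.differentiableWithinAt)
      (fun z hz => (hd z hz).fderiv)
    have hmem : Metric.ball (chartAt ℂ p p) r \ {chartAt ℂ p p} ∈ 𝓝[≠] (chartAt ℂ p p) :=
      Filter.inter_mem (nhdsWithin_le_nhds (Metric.ball_mem_nhds _ hr)) self_mem_nhdsWithin
    obtain ⟨z₁, hz₁⟩ := Filter.nonempty_of_mem hmem
    refine ⟨h ((chartAt ℂ p).symm z₁), (eventually_nhdsNE_iff_chart p).2 ?_⟩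
    filter_upwards [hmem] with z hz
    exact hconst hz hz₁
  choose c hc using key
  have hloc : IsLocallyConstant c := by
    rw [IsLocallyConstant.iff_eventually_eq]
    intro p
    have h1 : ∀ᶠ y in 𝓝[≠] p, c y = c p := by
      filter_upwards [eventually_eventually_nhdsWithin.2 (hc p), self_mem_nhdsWithin] with x hx hxp
      rw [isOpen_compl_singleton.nhdsWithin_eq hxp] at hx
      have := nhdsNE_neBot x
      obtain ⟨y, hy1, hy2⟩ := ((hc x).and (hx.filter_mono nhdsWithin_le_nhds)).exists
      rw [← hy1, ← hy2]
    rw [eventually_nhdsWithin_iff] at h1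
    filter_upwards [h1] with y hy
    by_cases hyp : y = p
    · rw [hyp]
    · exact hy hyp
  obtain ⟨p₀⟩ := (inferInstance : Nonempty M)
  refine ⟨c p₀, eventually_codiscrete_iff.2 fun p => ?_⟩
  rw [hloc.apply_eq_of_isPreconnected isPreconnected_univ (Set.mem_univ p₀) (Set.mem_univ p)]
  exact hc p

end Codiscrete

/-! ### Algebra of the Weierstrass representation -/

section WeierstrassAlgebra

open Complex

/-- The map `a ↦ Re (a φ(g))` to Euclidean 3-space, where `φ(g) = (2g, 1 - g², -i(1 + g²))` is
the null vector with stereographic parameter `g`: a surface with Weierstrass data has differential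
`df = weierstrassMap g ∘ ω`. -/
noncomputable def weierstrassMap (g : ℂ) : ℂ →L[ℝ] R3 :=
  LinearMap.toContinuousLinearMap
    { toFun := fun a => !₂[2 * (g * a).re, ((1 - g ^ 2) * a).re, ((1 + g ^ 2) * a).im]
      map_add' := fun a b => by
        ext i; fin_cases i <;> simp [mul_add]
      map_smul' := fun r a => by
        ext i; fin_cases i <;> simp <;> ring }

theorem weierstrassMap_apply (g a : ℂ) : weierstrassMap g a =
    !₂[2 * (g * a).re, ((1 - g ^ 2) * a).re, ((1 + g ^ 2) * a).im] := rfl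

/-- The unit normal of `weierstrassMap g`: the point of the unit sphere with stereographic
parameter `g`. -/
noncomputable def gaussVec (g : ℂ) : R3 :=
  (1 + normSq g)⁻¹ • !₂[1 - normSq g, -2 * g.re, 2 * g.im]

theorem inner_R3 (x y : R3) : inner ℝ x y = x 0 * y 0 + x 1 * y 1 + x 2 * y 2 := by
  simp [PiLp.inner_apply, Fin.sum_univ_three]; ring

theorem norm_sq_R3 (x : R3) : ‖x‖ ^ 2 = x 0 ^ 2 + x 1 ^ 2 + x 2 ^ 2 := by
  rw [← real_inner_self_eq_norm_sq, inner_R3]; ring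

theorem cross_apply (x y : R3) : cross x y =
    !₂[x 1 * y 2 - x 2 * y 1, x 2 * y 0 - x 0 * y 2, x 0 * y 1 - x 1 * y 0] := by
  simp [cross, crossProduct]

theorem one_add_normSq_pos (g : ℂ) : 0 < 1 + normSq g := by
  linarith [normSq_nonneg g]

theorem norm_gaussVec (g : ℂ) : ‖gaussVec g‖ = 1 := by
  have h := (one_add_normSq_pos g).ne'
  have h1 : ‖gaussVec g‖ ^ 2 = 1 ^ 2 := by
    rw [norm_sq_R3]
    simp only [gaussVec, PiLp.smul_apply, smul_eq_mul]
    simp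
    field_simp
    rw [normSq_apply]
    ring
  exact (pow_left_inj₀ (norm_nonneg _) zero_le_one two_ne_zero).1 h1

theorem inner_gaussVec_weierstrassMap (g a : ℂ) :
    inner ℝ (gaussVec g) (weierstrassMap g a) = 0 := by
  have h := (one_add_normSq_pos g).ne'
  rw [inner_R3]
  simp [gaussVec, weierstrassMap_apply, pow_two]
  field_simp
  rw [normSq_apply]
  ring

/-- The normal `gaussVec g` has the right orientation. -/
theorem cross_weierstrassMap (g a : ℂ) :
    cross (weierstrassMap g a) (weierstrassMap g (a * I)) =
      (normSq a * (1 + normSq g) ^ 2) • gaussVec g := by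
  have h := (one_add_normSq_pos g).ne'
  have h2 : (normSq a * (1 + normSq g) ^ 2) • gaussVec g =
      (normSq a * (1 + normSq g)) • !₂[1 - normSq g, -2 * g.re, 2 * g.im] := by
    rw [gaussVec, smul_smul]; congr 1; field_simp
  rw [h2, cross_apply]
  ext i
  fin_cases i <;> simp [weierstrassMap_apply, pow_two, normSq_apply] <;> ring

theorem normalize_cross_weierstrassMap {g a : ℂ} (ha : a ≠ 0) :
    ‖cross (weierstrassMap g a) (weierstrassMap g (a * I))‖⁻¹ •
      cross (weierstrassMap g a) (weierstrassMap g (a * I)) = gaussVec g := by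
  have h : 0 < normSq a * (1 + normSq g) ^ 2 :=
    mul_pos (normSq_pos.2 ha) (pow_pos (one_add_normSq_pos g) 2)
  rw [cross_weierstrassMap, norm_smul, norm_gaussVec, mul_one, Real.norm_of_nonneg h.le,
    inv_smul_smul₀ h.ne']

/-- The real part of the complex vector `u (g + ĝ, 1 - gĝ, -i(1 + gĝ))`, `u = (ĝ - g)⁻¹`, which
is orthogonal to the null vectors `φ(g)` and `φ(ĝ)` and has complex square `1`. -/
noncomputable def midVec (g gh : ℂ) : R3 :=
  !₂[((g + gh) / (gh - g)).re, ((1 - g * gh) / (gh - g)).re, ((1 + g * gh) / (gh - g)).im]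

theorem normSq_sub_mul_norm_midVec {g gh : ℂ} (h : g ≠ gh) :
    normSq (gh - g) * ‖midVec g gh‖ ^ 2 = (1 + normSq g) * (1 + normSq gh) := by
  have h0 : normSq (gh - g) ≠ 0 := (normSq_pos.2 (sub_ne_zero.2 h.symm)).ne'
  rw [norm_sq_R3]
  simp [midVec, div_re, div_im]
  field_simp
  simp [normSq_apply]
  ring

theorem one_le_norm_midVec_sq {g gh : ℂ} (h : g ≠ gh) : 1 ≤ ‖midVec g gh‖ ^ 2 := by
  have h0 : 0 < normSq (gh - g) := normSq_pos.2 (sub_ne_zero.2 h.symm)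
  have h1 := normSq_sub_mul_norm_midVec h
  have h2 : normSq (gh - g) ≤ (1 + normSq g) * (1 + normSq gh) := by
    simp only [normSq_apply, sub_re, sub_im]
    nlinarith [sq_nonneg (1 + g.re * gh.re + g.im * gh.im), sq_nonneg (g.re * gh.im - g.im * gh.re)]
  by_contra hlt
  nlinarith [sq_nonneg ‖midVec g gh‖]

theorem midVec_ne_zero {g gh : ℂ} (h : g ≠ gh) : midVec g gh ≠ 0 := by
  intro h0
  have := one_le_norm_midVec_sq h
  rw [h0] at this
  norm_num at this

theorem gaussVec_sub_gaussVec {g gh : ℂ} (h : g ≠ gh) :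
    gaussVec g - gaussVec gh = (2 / ‖midVec g gh‖ ^ 2) • midVec g gh := by
  have h0 : normSq (gh - g) ≠ 0 := (normSq_pos.2 (sub_ne_zero.2 h.symm)).ne'
  have h1 := (one_add_normSq_pos g).ne'
  have h2 := (one_add_normSq_pos gh).ne'
  have h3 : 2 / ‖midVec g gh‖ ^ 2 = 2 * normSq (gh - g) / ((1 + normSq g) * (1 + normSq gh)) := by
    rw [← normSq_sub_mul_norm_midVec h]
    have h4 : ‖midVec g gh‖ ^ 2 ≠ 0 := by have := one_le_norm_midVec_sq h; positivity
    field_simp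
  rw [h3]
  ext i
  fin_cases i <;> simp [gaussVec, midVec, div_re, div_im] <;> field_simp <;>
    simp [normSq_apply] <;> ring

/-- If both real parts below are multiples of `midVec`, then all coefficients vanish. Together the
equations say that a combination of the null vectors `φ(g)`, `φ(ĝ)` is a complex multiple of the real
vector `midVec g ĝ = Re X`; but `X` is orthogonal to both null vectors, while the real part of
`X · Re X` is `|Re X|² > 0`. -/
theorem eq_zero_of_weierstrassMap_sub {g gh a ah : ℂ} {s₁ s₂ : ℝ} (h : g ≠ gh)
    (h1 : weierstrassMap gh ah - weierstrassMap g a = s₁ • midVec g gh)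
    (h2 : weierstrassMap gh (ah * I) - weierstrassMap g (a * I) = s₂ • midVec g gh) :
    a = 0 ∧ ah = 0 ∧ s₁ = 0 ∧ s₂ = 0 := by
  have hne : gh - g ≠ 0 := sub_ne_zero.2 h.symm
  have hn := one_le_norm_midVec_sq h
  rw [norm_sq_R3] at hn
  obtain ⟨r, hr⟩ : ∃ r, r = midVec g gh := ⟨_, rfl⟩
  rw [← hr] at h1 h2 hn
  set s : ℂ := s₁ - s₂ * I with hs
  -- The two real vector equations are the real and imaginary parts of one complex equation.
  have e0 : 2 * gh * ah - 2 * g * a = s * r 0 := by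
    have h10 := congrArg (fun v : R3 => v 0) h1
    have h20 := congrArg (fun v : R3 => v 0) h2
    simp [weierstrassMap_apply] at h10 h20
    apply Complex.ext <;> simp [hs] <;> linarith
  have e1 : (1 - gh ^ 2) * ah - (1 - g ^ 2) * a = s * r 1 := by
    have h10 := congrArg (fun v : R3 => v 1) h1
    have h20 := congrArg (fun v : R3 => v 1) h2
    simp [weierstrassMap_apply] at h10 h20
    apply Complex.ext <;> simp [hs] <;> linarith
  have e2 : (1 + gh ^ 2) * ah - (1 + g ^ 2) * a = s * r 2 * I := by
    have h10 := congrArg (fun v : R3 => v 2) h1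
    have h20 := congrArg (fun v : R3 => v 2) h2
    simp [weierstrassMap_apply] at h10 h20
    apply Complex.ext <;> simp [hs] <;> linarith
  -- Pair the complex equation with the complex vector behind `midVec`, orthogonal to the left side.
  have e3 : s * ((g + gh) / (gh - g) * r 0 + (1 - g * gh) / (gh - g) * r 1
      + -I * ((1 + g * gh) / (gh - g)) * r 2) = 0 := by
    have : s * ((g + gh) * r 0 + (1 - g * gh) * r 1 + -I * (1 + g * gh) * r 2) = 0 := by
      linear_combination (-(g + gh)) * e0 - (1 - g * gh) * e1 + (1 + g * gh) * e2
    calc _ = s * ((g + gh) * r 0 + (1 - g * gh) * r 1 + -I * (1 + g * gh) * r 2) / (gh - g) := by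
          ring
      _ = 0 := by rw [this, zero_div]
  have hs0 : s = 0 := by
    refine (mul_eq_zero.1 e3).resolve_right fun h0 => ?_
    have h0' := congrArg Complex.re h0
    have hr0 : ((g + gh) / (gh - g)).re = r 0 := by rw [hr]; simp [midVec]
    have hr1 : ((1 - g * gh) / (gh - g)).re = r 1 := by rw [hr]; simp [midVec]
    have hr2 : ((1 + g * gh) / (gh - g)).im = r 2 := by rw [hr]; simp [midVec]
    rw [add_re, add_re, re_mul_ofReal, re_mul_ofReal, re_mul_ofReal, hr0, hr1] at h0'
    have h4 : (-I * ((1 + g * gh) / (gh - g))).re = r 2 := by rw [← hr2]; simp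
    rw [h4] at h0'
    simp at h0'
    nlinarith
  rw [hs0] at e0 e1 e2
  have e4 : ah = a := by linear_combination (e1 + e2) / 2
  have e5 : (gh - g) * a = 0 := by rw [e4] at e0; linear_combination e0 / 2
  have e6 := (mul_eq_zero.1 e5).resolve_left hne
  have hre := congrArg Complex.re hs0
  have him := congrArg Complex.im hs0
  simp [hs] at hre him
  exact ⟨e6, e4.trans e6, hre, him⟩

end WeierstrassAlgebra

/-! ### Calculus of the Weierstrass representation -/

section WeierstrassCalculus

open Complex

variable {G Gh : ℂ → ℂ} {G' Gh' : ℂ} {z : ℂ}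

theorem hasFDerivAt_re {X : ℂ → ℂ} {X' : ℂ} (h : HasDerivAt X X' z) :
    HasFDerivAt (fun w => (X w).re) (reCLM.comp (ContinuousLinearMap.mul ℝ ℂ X')) z := by
  have h1 := reCLM.hasFDerivAt.comp z (h.hasFDerivAt.restrictScalars ℝ)
  refine h1.congr_fderiv ?_
  ext w
  simp [mul_comm X' w]

theorem hasFDerivAt_im {X : ℂ → ℂ} {X' : ℂ} (h : HasDerivAt X X' z) :
    HasFDerivAt (fun w => (X w).im) (imCLM.comp (ContinuousLinearMap.mul ℝ ℂ X')) z := by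
  have h1 := imCLM.hasFDerivAt.comp z (h.hasFDerivAt.restrictScalars ℝ)
  refine h1.congr_fderiv ?_
  ext w
  simp [mul_comm X' w]

theorem hasFDerivAt_midVec (hG : HasDerivAt G G' z) (hGh : HasDerivAt Gh Gh' z)
    (h : G z ≠ Gh z) :
    HasFDerivAt (fun w => midVec (G w) (Gh w))
      ((weierstrassMap (Gh z)).comp (ContinuousLinearMap.mul ℝ ℂ (G' / (Gh z - G z) ^ 2)) -
        (weierstrassMap (G z)).comp (ContinuousLinearMap.mul ℝ ℂ (Gh' / (Gh z - G z) ^ 2))) z := by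
  have hne : Gh z - G z ≠ 0 := sub_ne_zero.2 h.symm
  rw [← hasFDerivWithinAt_univ, hasFDerivWithinAt_euclidean]
  intro i
  rw [hasFDerivWithinAt_univ]
  fin_cases i
  · refine (hasFDerivAt_re ((hG.add hGh).div (hGh.sub hG) hne)).congr_fderiv ?_
    ext1 w
    simp only [weierstrassMap_apply, ContinuousLinearMap.comp_apply, reCLM_apply,
      sub_apply, ContinuousLinearMap.mul_apply', PiLp.proj_apply,
      PiLp.sub_apply, Fin.zero_eta, Matrix.cons_val_zero, Pi.add_apply, Pi.sub_apply]
    rw [← mul_sub, ← sub_re, ← re_ofReal_mul]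
    congr 1
    field_simp
    push_cast
    ring
  · refine (hasFDerivAt_re (((hG.mul hGh).const_sub 1).div (hGh.sub hG) hne)).congr_fderiv ?_
    ext1 w
    simp only [weierstrassMap_apply, ContinuousLinearMap.comp_apply, reCLM_apply,
      sub_apply, ContinuousLinearMap.mul_apply', PiLp.proj_apply,
      PiLp.sub_apply, Fin.mk_one, Matrix.cons_val_one, Matrix.cons_val_zero, Pi.mul_apply,
      Pi.sub_apply]
    rw [← sub_re]
    congr 1
    field_simp
    ring
  · refine (hasFDerivAt_im (((hG.mul hGh).const_add 1).div (hGh.sub hG) hne)).congr_fderiv ?_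
    ext1 w
    simp only [weierstrassMap_apply, ContinuousLinearMap.comp_apply, imCLM_apply,
      sub_apply, ContinuousLinearMap.mul_apply', PiLp.proj_apply,
      PiLp.sub_apply, Fin.reduceFinMk, Matrix.cons_val, Pi.mul_apply, Pi.sub_apply]
    rw [← sub_im]
    congr 1
    field_simp
    ring

theorem inner_gaussVec_eq (g : ℂ) (y : R3) : (1 + normSq g) * inner ℝ (gaussVec g) y =
    y 0 * (1 - (g.re ^ 2 + g.im ^ 2)) - 2 * y 1 * g.re + 2 * y 2 * g.im := by
  have h := (one_add_normSq_pos g).ne'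
  rw [inner_R3]
  simp only [gaussVec, PiLp.smul_apply, smul_eq_mul]
  simp
  field_simp
  rw [normSq_apply]
  ring

/-- Multiplied by its denominator, the normal is a quadratic polynomial in `G`, which is easier to
differentiate than the normal itself. -/
theorem hasFDerivAt_stereo (hG : HasDerivAt G G' z) (y : R3) :
    ∃ L : ℂ →L[ℝ] ℝ, HasFDerivAt (fun w => (1 + normSq (G w)) * inner ℝ (gaussVec (G w)) y) L z ∧
      ∀ v, L v = -2 * (y 0 * ((G z).re * (G' * v).re + (G z).im * (G' * v).im)
        + y 1 * (G' * v).re - y 2 * (G' * v).im) := by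
  have h1 := hasFDerivAt_re hG
  have h2 := hasFDerivAt_im hG
  simp only [inner_gaussVec_eq]
  refine ⟨_, (((((h1.pow 2).add (h2.pow 2)).const_sub 1).const_mul (y 0)).sub
    (h1.const_mul (2 * y 1))).add (h2.const_mul (2 * y 2)), fun v => ?_⟩
  simp
  ring

theorem differentiableAt_gaussVec (hG : HasDerivAt G G' z) :
    DifferentiableAt ℝ (fun w => gaussVec (G w)) z := by
  have h1 := (hasFDerivAt_re hG).differentiableAt
  have h2 := (hasFDerivAt_im hG).differentiableAt
  rw [differentiableAt_euclidean]
  have h3 : DifferentiableAt ℝ (fun w => normSq (G w)) z := by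
    simp only [normSq_apply]; fun_prop
  have h4 : DifferentiableAt ℝ (fun w => (1 + normSq (G w))⁻¹) z :=
    (h3.const_add 1).inv (one_add_normSq_pos _).ne'
  intro i
  fin_cases i <;> simp [gaussVec] <;> fun_prop

/-- The second fundamental form in terms of the Weierstrass data. -/
theorem inner_fderiv_gaussVec (hG : HasDerivAt G G' z) {L : ℂ →L[ℝ] R3}
    (hL : HasFDerivAt (fun w => gaussVec (G w)) L z) (v a : ℂ) :
    inner ℝ (L v) (weierstrassMap (G z) a) = -2 * (G' * v * a).re := by
  set y := weierstrassMap (G z) a with hy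
  obtain ⟨K, hK, hKv⟩ := hasFDerivAt_stereo hG y
  have h3 : DifferentiableAt ℝ (fun w => 1 + normSq (G w)) z := by
    have h1 := (hasFDerivAt_re hG).differentiableAt
    have h2 := (hasFDerivAt_im hG).differentiableAt
    simp only [normSq_apply]; fun_prop
  have h4 := h3.hasFDerivAt.mul (hL.inner ℝ (hasFDerivAt_const y z))
  have h5 := congrArg (fun T : ℂ →L[ℝ] ℝ => T v) (hK.unique h4)
  simp only [hKv] at h5
  have h0 : inner ℝ (gaussVec (G z)) y = 0 := inner_gaussVec_weierstrassMap _ _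
  simp [h0] at h5
  have hpos := one_add_normSq_pos (G z)
  refine mul_left_cancel₀ hpos.ne' (h5.symm.trans ?_)
  simp [hy, weierstrassMap_apply, normSq_apply, pow_two]
  ring

/-- A nonvanishing vector field that stays orthogonal to the normal of a surface while its
derivative is tangent to the surface forces the Gauss map to be singular. -/
theorem deriv_eq_zero_of_inner_gaussVec (hG : HasDerivAt G G' z) {F : ℂ → R3} {L : ℂ →L[ℝ] R3}
    (hF : HasFDerivAt F L z) (hF0 : F z ≠ 0) (hL : ∀ v, inner ℝ (gaussVec (G z)) (L v) = 0)
    (h : ∀ᶠ w in 𝓝 z, inner ℝ (gaussVec (G w)) (F w) = 0) : G' = 0 := by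
  by_contra hG0
  obtain ⟨N, hN⟩ := differentiableAt_gaussVec hG
  have h1 : HasFDerivAt (fun w => inner ℝ (gaussVec (G w)) (F w)) (0 : ℂ →L[ℝ] ℝ) z :=
    (hasFDerivAt_const (0 : ℝ) z).congr_of_eventuallyEq h
  have h2 := hN.inner ℝ hF
  have h3 : ∀ v, inner ℝ (N v) (F z) = 0 := fun v => by
    have := congrArg (fun T : ℂ →L[ℝ] ℝ => T v) (h1.unique h2)
    simp [hL] at this
    exact this.symm
  obtain ⟨K, hK, hKv⟩ := hasFDerivAt_stereo hG (F z)
  have h4 : DifferentiableAt ℝ (fun w => 1 + normSq (G w)) z := by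
    have h1 := (hasFDerivAt_re hG).differentiableAt
    have h2 := (hasFDerivAt_im hG).differentiableAt
    simp only [normSq_apply]; fun_prop
  have h5 := h4.hasFDerivAt.mul (hN.inner ℝ (hasFDerivAt_const (F z) z))
  have h6 : ∀ v, K v = 0 := fun v => by
    have := congrArg (fun T : ℂ →L[ℝ] ℝ => T v) (hK.unique h5)
    simp [h3, h.self_of_nhds] at this
    exact this
  have e0 := inner_gaussVec_eq (G z) (F z)
  rw [h.self_of_nhds] at e0
  -- As `G'` is invertible, `F z` is orthogonal to all derivatives of the stereographic projection.
  have e1 := (hKv (1 / G')).symm.trans (h6 _)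
  have e2 := (hKv (I / G')).symm.trans (h6 _)
  rw [mul_div_cancel₀ _ hG0] at e1 e2
  simp at e1 e2
  have hy1 : F z 1 = -(F z 0 * (G z).re) := by linarith
  have hy2 : F z 2 = F z 0 * (G z).im := by linarith
  have hy0 : F z 0 * (1 + ((G z).re ^ 2 + (G z).im ^ 2)) = 0 := by
    rw [hy1, hy2] at e0; linarith
  have hy0 : F z 0 = 0 := (mul_eq_zero.1 hy0).resolve_right (by positivity)
  apply hF0
  ext i
  fin_cases i <;> simp [hy0, hy1, hy2]

/-- If two immersions with Weierstrass data `(G, b)`, `(Ĝ, b̂)` envelop a congruence of oriented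
spheres, so that the difference `F` of the immersions is parallel to the difference of the normals,
then the ratio `s` of `F` to `midVec G Ĝ` has vanishing derivative, and it determines `b`, `b̂`. -/
theorem ratio_of_parallel (hG : HasDerivAt G G' z) (hGh : HasDerivAt Gh Gh' z) (h : G z ≠ Gh z)
    {F : ℂ → R3} {b bh : ℂ}
    (hF : HasFDerivAt F ((weierstrassMap (Gh z)).comp (ContinuousLinearMap.mul ℝ ℂ bh) -
      (weierstrassMap (G z)).comp (ContinuousLinearMap.mul ℝ ℂ b)) z)
    (hpar : ∀ᶠ w in 𝓝 z, ∃ a : ℝ, gaussVec (G w) - gaussVec (Gh w) = a • F w) :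
    ∃ s : ℝ, F z = s • midVec (G z) (Gh z) ∧
      b = s * (Gh' / (Gh z - G z) ^ 2) ∧ bh = s * (G' / (Gh z - G z) ^ 2) ∧
      inner ℝ (F z) (midVec (G z) (Gh z)) / ‖midVec (G z) (Gh z)‖ ^ 2 = s ∧
      HasFDerivAt (fun w => inner ℝ (F w) (midVec (G w) (Gh w)) / ‖midVec (G w) (Gh w)‖ ^ 2)
        (0 : ℂ →L[ℝ] ℝ) z := by
  have hX := hasFDerivAt_midVec hG hGh h
  have hne : ∀ᶠ w in 𝓝 z, G w ≠ Gh w := by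
    filter_upwards [(hG.continuousAt.sub hGh.continuousAt).eventually_ne (sub_ne_zero.2 h)]
      with w hw
    exact sub_ne_zero.1 hw
  set s : ℂ → ℝ := fun w => inner ℝ (F w) (midVec (G w) (Gh w)) / ‖midVec (G w) (Gh w)‖ ^ 2
    with hs
  have hFs : ∀ᶠ w in 𝓝 z, F w = s w • midVec (G w) (Gh w) := by
    filter_upwards [hpar, hne] with w ⟨a, ha⟩ hw
    rw [gaussVec_sub_gaussVec hw] at ha
    have hn : ‖midVec (G w) (Gh w)‖ ≠ 0 := norm_ne_zero_iff.2 (midVec_ne_zero hw)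
    have ha0 : a ≠ 0 := by
      rintro rfl
      rw [zero_smul, smul_eq_zero] at ha
      exact ha.elim (div_ne_zero two_ne_zero (pow_ne_zero 2 hn)) (midVec_ne_zero hw)
    have hFw : F w = (a⁻¹ * (2 / ‖midVec (G w) (Gh w)‖ ^ 2)) • midVec (G w) (Gh w) := by
      rw [mul_smul, ha, inv_smul_smul₀ ha0]
    have hsw : s w = a⁻¹ * (2 / ‖midVec (G w) (Gh w)‖ ^ 2) := by
      simp only [hs]
      rw [hFw, real_inner_smul_left, real_inner_self_eq_norm_sq]
      field_simp
    rw [hsw]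
    exact hFw
  have hsd : DifferentiableAt ℝ s z := by
    have h1 := hF.differentiableAt.inner ℝ hX.differentiableAt
    have h2 := hX.differentiableAt.norm_sq ℝ
    simp only [hs, div_eq_mul_inv]
    exact h1.mul (h2.inv (pow_ne_zero 2 (norm_ne_zero_iff.2 (midVec_ne_zero h))))
  have hF2 := (hsd.hasFDerivAt.smul hX).congr_of_eventuallyEq hFs
  have huniq := hF.unique hF2
  have key : ∀ v, weierstrassMap (Gh z) ((bh - s z * (G' / (Gh z - G z) ^ 2)) * v) -
      weierstrassMap (G z) ((b - s z * (Gh' / (Gh z - G z) ^ 2)) * v) =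
        (fderiv ℝ s z v) • midVec (G z) (Gh z) := by
    intro v
    have h1 := congrArg (fun T : ℂ →L[ℝ] R3 => T v) huniq
    simp at h1
    have h2 : ∀ g c : ℂ, weierstrassMap g (s z * c * v) = s z • weierstrassMap g (c * v) := by
      intro g c
      rw [← map_smul, real_smul, mul_assoc]
    rw [sub_mul, sub_mul, map_sub, map_sub, h2, h2]
    rw [smul_sub] at h1
    rw [sub_eq_iff_eq_add] at h1
    rw [h1]
    abel
  have k1 := key 1
  rw [mul_one, mul_one] at k1
  obtain ⟨e1, e2, -, -⟩ := eq_zero_of_weierstrassMap_sub h k1 (key I)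
  refine ⟨s z, hFs.self_of_nhds, sub_eq_zero.1 e1, sub_eq_zero.1 e2, rfl, ?_⟩
  have h0 : fderiv ℝ s z = 0 := by
    ext1 v
    have := key v
    simp only [e1, e2, zero_mul, map_zero, sub_zero] at this
    exact (smul_eq_zero.1 this.symm).resolve_right (midVec_ne_zero h)
  rw [← h0]
  exact hsd.hasFDerivAt

end WeierstrassCalculus

/-! ### Conformal immersions and their shape operators -/

section Immersions

open Complex

theorem norm_cross_sq (x y : R3) :
    ‖cross x y‖ ^ 2 = ‖x‖ ^ 2 * ‖y‖ ^ 2 - inner ℝ x y ^ 2 := by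
  simp only [norm_sq_R3, inner_R3, cross_apply]
  simp
  ring

theorem inner_cross_left (x y : R3) : inner ℝ (cross x y) x = 0 := by
  simp only [inner_R3, cross_apply]; simp; ring

theorem inner_cross_right (x y : R3) : inner ℝ (cross x y) y = 0 := by
  simp only [inner_R3, cross_apply]; simp; ring

theorem eq_zero_of_inner_eq_zero {x y d : R3} (hc : cross x y ≠ 0) (hx : inner ℝ d x = 0)
    (hy : inner ℝ d y = 0) (hd : inner ℝ d (cross x y) = 0) : d = 0 := by
  have h : ‖cross x y‖ ^ 2 • d = inner ℝ d (cross x y) • cross x y +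
      inner ℝ d x • cross y (cross x y) + inner ℝ d y • cross (cross x y) x := by
    simp only [norm_sq_R3, inner_R3, cross_apply]
    ext i
    fin_cases i <;> simp <;> ring
  rw [hx, hy, hd] at h
  simp only [zero_smul, add_zero] at h
  exact (smul_eq_zero.1 h).resolve_left (pow_ne_zero 2 (norm_ne_zero_iff.2 hc))

/-- The unit normal of an oriented plane with positive basis `x, y`. -/
noncomputable def unitNormal (x y : R3) : R3 := ‖cross x y‖⁻¹ • cross x y

/-- The unit normal does not depend on the choice of a positive conformal basis `τ, iτ`. -/
theorem unitNormal_map_mul (L : ℂ →L[ℝ] R3) {τ : ℂ} (hτ : τ ≠ 0) :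
    unitNormal (L τ) (L (τ * I)) = unitNormal (L 1) (L I) := by
  have h0 : 0 < normSq τ := normSq_pos.2 hτ
  have h1 : L τ = τ.re • L 1 + τ.im • L I := by
    rw [← map_smul, ← map_smul, ← map_add]; congr 1; apply Complex.ext <;> simp
  have h2 : L (τ * I) = (-τ.im) • L 1 + τ.re • L I := by
    rw [← map_smul, ← map_smul, ← map_add]; congr 1; apply Complex.ext <;> simp
  have h3 : cross (L τ) (L (τ * I)) = normSq τ • cross (L 1) (L I) := by
    rw [h1, h2, normSq_apply]
    simp only [cross_apply]
    ext i
    fin_cases i <;> simp <;> ring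
  rw [unitNormal, h3, norm_smul, Real.norm_of_nonneg h0.le, smul_smul, mul_inv, mul_right_comm,
    inv_mul_cancel₀ h0.ne', one_mul, unitNormal]

theorem contDiffAt_unitNormal {A B : ℂ → R3} {z : ℂ} {n : WithTop ℕ∞} (hA : ContDiffAt ℝ n A z)
    (hB : ContDiffAt ℝ n B z) (h : cross (A z) (B z) ≠ 0) :
    ContDiffAt ℝ n (fun w => unitNormal (A w) (B w)) z := by
  have hA' := contDiffAt_euclidean.1 hA
  have hB' := contDiffAt_euclidean.1 hB
  have hc : ContDiffAt ℝ n (fun w => cross (A w) (B w)) z := by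
    rw [contDiffAt_euclidean]
    have h0 := hA' 0
    have h1 := hA' 1
    have h2 := hA' 2
    have k0 := hB' 0
    have k1 := hB' 1
    have k2 := hB' 2
    intro i
    fin_cases i <;> simp [cross_apply] <;> fun_prop
  exact ((hc.norm ℝ h).inv (norm_ne_zero_iff.2 h)).smul hc

theorem exists_inner_map_eq {L : ℂ →L[ℝ] R3} (hL : IsConformalMap L) :
    ∃ lam : ℝ, 0 < lam ∧ ∀ v w, inner ℝ (L v) (L w) = lam * inner ℝ v w := by
  obtain ⟨c, hc, li, rfl⟩ := hL
  refine ⟨c * c, mul_self_pos.2 hc, fun v w => ?_⟩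
  simp [real_inner_smul_left, real_inner_smul_right, li.inner_map_map, mul_assoc]

theorem cross_map_ne_zero {L : ℂ →L[ℝ] R3} (hL : IsConformalMap L) : cross (L 1) (L I) ≠ 0 := by
  obtain ⟨lam, hpos, h⟩ := exists_inner_map_eq hL
  intro h0
  have h1 := norm_cross_sq (L 1) (L I)
  rw [h0, ← real_inner_self_eq_norm_sq, ← real_inner_self_eq_norm_sq, ← real_inner_self_eq_norm_sq,
    h, h, h] at h1
  simp at h1
  exact hpos.ne' h1

variable {M : Type*} [TopologicalSpace M] [ChartedSpace ℂ M]

theorem gaussMap_eq_unitNormal (f : M → R3) (p : M) :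
    gaussMap f p = unitNormal (diff f p 1) (diff f p I) := rfl

namespace IsConformalImmersion

variable {f : M → R3}

theorem mdifferentiableAt (hf : IsConformalImmersion f) (p : M) :
    MDifferentiableAt 𝓘(ℝ, ℂ) 𝓘(ℝ, R3) f p :=
  hf.1.mdifferentiableAt (by simp)

theorem hasMFDerivAt (hf : IsConformalImmersion f) (p : M) :
    HasMFDerivAt 𝓘(ℝ, ℂ) 𝓘(ℝ, R3) f p (diff f p) :=
  (hf.mdifferentiableAt p).hasMFDerivAt

theorem norm_gaussMap (hf : IsConformalImmersion f) (p : M) : ‖gaussMap f p‖ = 1 := by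
  have h := cross_map_ne_zero (hf.2 p)
  rw [gaussMap, norm_smul, norm_inv, norm_norm, inv_mul_cancel₀ (norm_ne_zero_iff.2 h)]

variable [IsManifold 𝓘(ℂ, ℂ) ω M]

theorem hasFDerivAt_chart (hf : IsConformalImmersion f) (p₀ : M) {z : ℂ}
    (hz : z ∈ (chartAt ℂ p₀).target) :
    HasFDerivAt (f ∘ (chartAt ℂ p₀).symm) ((diff f ((chartAt ℂ p₀).symm z)).comp
      (ContinuousLinearMap.mul ℝ ℂ (coordVec p₀ z))) z :=
  hasFDerivAt_comp_chart_symm p₀ hz (hf.hasMFDerivAt _)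

theorem contDiffAt_chart (hf : IsConformalImmersion f) (p₀ : M) {z : ℂ}
    (hz : z ∈ (chartAt ℂ p₀).target) : ContDiffAt ℝ ∞ (f ∘ (chartAt ℂ p₀).symm) z := by
  have := isManifold_real M
  rw [← contMDiffAt_iff_contDiffAt]
  have h1 : ContMDiffAt 𝓘(ℝ, ℂ) 𝓘(ℝ, ℂ) ∞ (chartAt ℂ p₀).symm z :=
    (contMDiffOn_chart_symm (I := 𝓘(ℝ, ℂ)) (n := ∞) (x := p₀)).contMDiffAt
      ((chartAt ℂ p₀).open_target.mem_nhds hz)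
  exact hf.1.contMDiffAt.comp z h1

theorem gaussMap_chart (hf : IsConformalImmersion f) (p₀ : M) {z : ℂ}
    (hz : z ∈ (chartAt ℂ p₀).target) :
    (gaussMap f ∘ (chartAt ℂ p₀).symm) z =
      unitNormal (fderiv ℝ (f ∘ (chartAt ℂ p₀).symm) z 1)
        (fderiv ℝ (f ∘ (chartAt ℂ p₀).symm) z I) := by
  rw [(hf.hasFDerivAt_chart p₀ hz).fderiv, Function.comp_apply, gaussMap_eq_unitNormal,
    ← unitNormal_map_mul _ (coordVec_ne_zero p₀ hz)]
  simp

theorem contDiffAt_gaussMap_chart (hf : IsConformalImmersion f) (p₀ : M) {z : ℂ}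
    (hz : z ∈ (chartAt ℂ p₀).target) :
    ContDiffAt ℝ 1 (gaussMap f ∘ (chartAt ℂ p₀).symm) z := by
  have hev : gaussMap f ∘ (chartAt ℂ p₀).symm =ᶠ[𝓝 z]
      fun z => unitNormal (fderiv ℝ (f ∘ (chartAt ℂ p₀).symm) z 1)
        (fderiv ℝ (f ∘ (chartAt ℂ p₀).symm) z I) := by
    filter_upwards [(chartAt ℂ p₀).open_target.mem_nhds hz] with w hw
    exact hf.gaussMap_chart p₀ hw
  refine ContDiffAt.congr_of_eventuallyEq ?_ hev
  have h1 : ContDiffAt ℝ 1 (fderiv ℝ (f ∘ (chartAt ℂ p₀).symm)) z :=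
    (hf.contDiffAt_chart p₀ hz).fderiv_right (m := 1) (by norm_cast)
  refine contDiffAt_unitNormal (h1.clm_apply contDiffAt_const) (h1.clm_apply contDiffAt_const) ?_
  intro h0
  have h2 := hf.gaussMap_chart p₀ hz
  rw [unitNormal, h0, smul_zero] at h2
  have h3 := hf.norm_gaussMap ((chartAt ℂ p₀).symm z)
  rw [Function.comp_apply] at h2
  rw [h2, norm_zero] at h3
  exact zero_ne_one h3

theorem hasMFDerivAt_gaussMap (hf : IsConformalImmersion f) (p : M) :
    HasMFDerivAt 𝓘(ℝ, ℂ) 𝓘(ℝ, R3) (gaussMap f) p (diff (gaussMap f) p) := by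
  have h := (hf.contDiffAt_gaussMap_chart p (mem_chart_target ℂ p)).differentiableAt one_ne_zero
  exact (hasMFDerivAt_iff_chart.2 h.hasFDerivAt).mdifferentiableAt.hasMFDerivAt

theorem continuous_gaussMap (hf : IsConformalImmersion f) : Continuous (gaussMap f) :=
  continuous_iff_continuousAt.2 fun p => (hf.hasMFDerivAt_gaussMap p).continuousAt

theorem inner_gaussMap_diff_gaussMap (hf : IsConformalImmersion f) (p : M) (v : ℂ) :
    inner ℝ (gaussMap f p) (diff (gaussMap f) p v) = 0 := by
  have h1 := hasMFDerivAt_iff_chart.1 (hf.hasMFDerivAt_gaussMap p)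
  have h2 := h1.norm_sq
  have h3 : (fun z => ‖(gaussMap f ∘ (chartAt ℂ p).symm) z‖ ^ 2) = fun _ => (1 : ℝ) := by
    ext z; simp [hf.norm_gaussMap]
  rw [h3] at h2
  have h4 := congrArg (fun T : ℂ →L[ℝ] ℝ => T v) ((hasFDerivAt_const (1 : ℝ) _).unique h2)
  simp [(chartAt ℂ p).left_inv (mem_chart_source ℂ p)] at h4
  exact h4

/-- As `dn` is tangent to the surface, the shape operator satisfies `df ∘ A = - dn`. -/
theorem diff_shapeOperator (hf : IsConformalImmersion f) (p : M) (v : ℂ) :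
    diff f p (shapeOperator f p v) = - diff (gaussMap f) p v := by
  obtain ⟨lam, hpos, h⟩ := exists_inner_map_eq (hf.2 p)
  have hc := cross_map_ne_zero (hf.2 p)
  set y := diff (gaussMap f) p v with hy
  -- `a` is the preimage of the orthogonal projection of `dn v` to the tangent plane.
  set a : ℂ := ⟨lam⁻¹ * inner ℝ y (diff f p 1), lam⁻¹ * inner ℝ y (diff f p I)⟩ with ha
  have hya : y = diff f p a := by
    have ha1 : diff f p a = a.re • diff f p 1 + a.im • diff f p I := by
      rw [← map_smul, ← map_smul, ← map_add]; congr 1; apply Complex.ext <;> simp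
    rw [← sub_eq_zero]
    refine eq_zero_of_inner_eq_zero hc ?_ ?_ ?_
    · rw [inner_sub_left, ha1, inner_add_left, real_inner_smul_left, real_inner_smul_left, h, h]
      simp [ha]
      field_simp
      ring
    · rw [inner_sub_left, ha1, inner_add_left, real_inner_smul_left, real_inner_smul_left, h, h]
      simp [ha]
      field_simp
      ring
    · have h1 := hf.inner_gaussMap_diff_gaussMap p v
      rw [← hy, gaussMap, real_inner_smul_left] at h1
      have h2 := (mul_eq_zero.1 h1).resolve_left (inv_ne_zero (norm_ne_zero_iff.2 hc))
      rw [inner_sub_left, ha1, inner_add_left, real_inner_smul_left, real_inner_smul_left,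
        real_inner_comm (cross _ _) y, h2, real_inner_comm (cross _ _) (diff f p 1),
        real_inner_comm (cross _ _) (diff f p I), inner_cross_left, inner_cross_right]
      ring
  have hinj : LinearMap.ker (diff f p).toLinearMap = ⊥ :=
    LinearMap.ker_eq_bot.2 (hf.2 p).injective
  have hA : shapeOperator f p v = -a := by
    have := LinearMap.leftInverse_apply_of_inj hinj a
    simp only [shapeOperator, LinearMap.neg_apply, LinearMap.comp_apply]
    congr 1
    refine Eq.trans ?_ this
    exact congrArg _ hya
  rw [hA, map_neg, hya]

end IsConformalImmersion

end Immersions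

/-! ### Surfaces with Weierstrass data -/

section WeierstrassData

open Complex

variable {M : Type*} [TopologicalSpace M] [ChartedSpace ℂ M]

theorem HolomorphicQuadraticDifferential.form_eq (q : HolomorphicQuadraticDifferential M) (p : M)
    (v : ℂ) : q.form p v = v ^ 2 * q.form p (1 : ℂ) := by
  have h := (q.form p).map_smul v (1 : ℂ)
  have h1 : (v • (1 : ℂ)) = v := by simp
  rw [pow_two]
  refine Eq.trans ?_ h
  exact congrArg (q.form p) h1.symm

/-- The coefficient of `dz²` in the chart at `p₀`. -/
noncomputable def HolomorphicQuadraticDifferential.coeff (q : HolomorphicQuadraticDifferential M)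
    (p₀ : M) (z : ℂ) : ℂ :=
  q.form ((chartAt ℂ p₀).symm z) (coordVec p₀ z)

theorem HolomorphicQuadraticDifferential.coeff_eq (q : HolomorphicQuadraticDifferential M)
    (p₀ : M) (z : ℂ) :
    q.coeff p₀ z = coordVec p₀ z ^ 2 * q.form ((chartAt ℂ p₀).symm z) (1 : ℂ) :=
  q.form_eq _ _

theorem HolomorphicQuadraticDifferential.coeff_self (q : HolomorphicQuadraticDifferential M)
    (p : M) : q.coeff p (chartAt ℂ p p) = q.form p (1 : ℂ) := by
  rw [q.coeff_eq, coordVec_self, (chartAt ℂ p).left_inv (mem_chart_source ℂ p)]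
  ring

theorem HolomorphicQuadraticDifferential.analyticAt_coeff (q : HolomorphicQuadraticDifferential M)
    (p : M) : AnalyticAt ℂ (q.coeff p) (chartAt ℂ p p) :=
  (q.holomorphic p).analyticAt ((chartAt ℂ p).open_target.mem_nhds (mem_chart_target ℂ p))

theorem eventually_mem_chart_target (p : M) :
    ∀ᶠ z in 𝓝[≠] (chartAt ℂ p p), z ∈ (chartAt ℂ p).target :=
  nhdsWithin_le_nhds ((chartAt ℂ p).open_target.mem_nhds (mem_chart_target ℂ p))

theorem eq_of_eventually_nhdsNE {E : Type*} [TopologicalSpace E] [T2Space E] {u v : ℂ → E} {z : ℂ}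
    (hu : ContinuousAt u z) (hv : ContinuousAt v z) (h : ∀ᶠ w in 𝓝[≠] z, u w = v w) :
    u z = v z :=
  tendsto_nhds_unique_of_eventuallyEq (hu.tendsto.mono_left nhdsWithin_le_nhds)
    (hv.tendsto.mono_left nhdsWithin_le_nhds) h

/-- Holomorphic quadratic differentials that agree off a discrete set are equal. -/
theorem HolomorphicQuadraticDifferential.eq_of_eventually
    {q qh : HolomorphicQuadraticDifferential M}
    (h : ∀ᶠ x in codiscrete M, qh.form x (1 : ℂ) = q.form x (1 : ℂ)) : qh = q := by
  have h1 : ∀ p, qh.form p (1 : ℂ) = q.form p (1 : ℂ) := by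
    intro p
    rw [← q.coeff_self, ← qh.coeff_self]
    refine eq_of_eventually_nhdsNE (qh.analyticAt_coeff p).continuousAt
      (q.analyticAt_coeff p).continuousAt ?_
    filter_upwards [(eventually_nhdsNE_iff_chart p).1 (eventually_codiscrete_iff.1 h p)] with z hz
    rw [q.coeff_eq, qh.coeff_eq, hz]
  have h2 : qh.form = q.form := by
    funext p
    ext v
    exact ((qh.form_eq p v).trans (congrArg (_ * ·) (h1 p))).trans (q.form_eq p v).symm
  cases q; cases qh; cases h2; rfl

theorem IsHolomorphicAt.hasDerivAt {g : M → ℂ} {p : M} (hg : IsHolomorphicAt g p) :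
    HasDerivAt (g ∘ (chartAt ℂ p).symm) (cdiff g p 1) (chartAt ℂ p p) := by
  have h : HasFDerivAt (g ∘ (chartAt ℂ p).symm) (cdiff g p) (chartAt ℂ p p) :=
    hasMFDerivAt_iff_chart.1 hg.hasMFDerivAt
  simpa using h.hasDerivAt

theorem cdiff_apply (g : M → ℂ) (p : M) (v : ℂ) : cdiff g p v = v * cdiff g p 1 := by
  have h := (cdiff g p).map_smul v 1
  simpa using h

theorem IsMeromorphicFunction.analyticAt {g : M → ℂ} (hg : IsMeromorphicFunction g) {p : M}
    (hp : IsHolomorphicAt g p) : AnalyticAt ℂ (g ∘ (chartAt ℂ p).symm) (chartAt ℂ p p) :=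
  (hg p).meromorphicAt.analyticAt hp.hasDerivAt.continuousAt

theorem eventually_nhds_chart {P : M → Prop} {p : M} (h : ∀ᶠ x in 𝓝 p, P x) :
    ∀ᶠ z in 𝓝 (chartAt ℂ p p), P ((chartAt ℂ p).symm z) := by
  have hc := (chartAt ℂ p).continuousAt_symm (mem_chart_target ℂ p)
  rw [ContinuousAt, (chartAt ℂ p).left_inv (mem_chart_source ℂ p)] at hc
  exact hc.eventually h

theorem IsMeromorphicFunction.eventually_eq_or_ne [T2Space M] [ConnectedSpace M] {g gh : M → ℂ}
    (hg : IsMeromorphicFunction g) (hgh : IsMeromorphicFunction gh) :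
    (∀ᶠ x in codiscrete M, g x = gh x) ∨ ∀ᶠ x in codiscrete M, g x ≠ gh x := by
  have (x : M) : (𝓝[≠] x).NeBot := nhdsNE_neBot x
  refine eventually_codiscrete_or_not fun p => ?_
  rcases ((hg p).meromorphicAt.sub (hgh p).meromorphicAt).eventually_eq_zero_or_eventually_ne_zero
    with h | h
  · refine .inl ((eventually_nhdsNE_iff_chart p).2 ?_)
    filter_upwards [h] with z hz
    exact sub_eq_zero.1 hz
  · refine .inr ((eventually_nhdsNE_iff_chart p).2 ?_)
    filter_upwards [h] with z hz
    exact sub_ne_zero.1 hz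

section Manifold

variable [IsManifold 𝓘(ℂ, ℂ) ω M]

theorem IsMeromorphicFunction.eventually_isHolomorphicAt {g : M → ℂ}
    (hg : IsMeromorphicFunction g) : ∀ᶠ x in codiscrete M, IsHolomorphicAt g x := by
  rw [eventually_codiscrete_iff]
  intro p
  rw [eventually_nhdsNE_iff_chart]
  filter_upwards [(hg p).meromorphicAt.eventually_analyticAt, eventually_mem_chart_target p]
    with z hz hzt
  exact (isHolomorphicAt_chart_symm p hzt).2 hz.differentiableAt

variable [T2Space M]

theorem HolomorphicQuadraticDifferential.eventually_eq_zero_or_ne [ConnectedSpace M]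
    (q : HolomorphicQuadraticDifferential M) :
    (∀ᶠ x in codiscrete M, q.form x (1 : ℂ) = 0) ∨
      ∀ᶠ x in codiscrete M, q.form x (1 : ℂ) ≠ 0 := by
  have (x : M) : (𝓝[≠] x).NeBot := nhdsNE_neBot x
  refine eventually_codiscrete_or_not fun p => ?_
  rcases (q.analyticAt_coeff p).eventually_eq_zero_or_eventually_ne_zero with h | h
  · refine .inl ((eventually_nhdsNE_iff_chart p).2 ?_)
    filter_upwards [nhdsWithin_le_nhds h, eventually_mem_chart_target p] with z hz hzt
    rw [q.coeff_eq] at hz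
    exact (mul_eq_zero.1 hz).resolve_left (pow_ne_zero 2 (coordVec_ne_zero p hzt))
  · refine .inr ((eventually_nhdsNE_iff_chart p).2 ?_)
    filter_upwards [h] with z hz h0
    rw [q.coeff_eq, h0, mul_zero] at hz
    exact hz rfl

end Manifold

/-- The coefficient of `dz` at `p` of the holomorphic differential of Weierstrass data. -/
theorem HasWeierstrassData.exists_coeff {f : M → R3} (hf : IsConformalImmersion f) {g : M → ℂ}
    {q : HolomorphicQuadraticDifferential M} (hW : HasWeierstrassData f g q) {p : M}
    (hp : IsHolomorphicAt g p) : ∃ b : ℂ, q.form p (1 : ℂ) = 2 * b * cdiff g p 1 ∧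
      diff f p = (weierstrassMap (g p)).comp (ContinuousLinearMap.mul ℝ ℂ b) ∧
      gaussMap f p = gaussVec (g p) := by
  obtain ⟨-, η, hη⟩ := hW
  have hd : diff f p = (weierstrassMap (g p)).comp
      (ContinuousLinearMap.mul ℝ ℂ (η.form p (1 : ℂ))) := by
    ext1 v
    have hv : η.form p v = η.form p (1 : ℂ) * v := by
      have h := (η.form p).map_smul v (1 : ℂ)
      have h1 : (v • (1 : ℂ)) = v := by simp
      rw [mul_comm]
      refine Eq.trans ?_ h
      exact congrArg (η.form p) h1.symm
    rw [(hη p hp v).2, hv]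
    rfl
  refine ⟨η.form p (1 : ℂ), (hη p hp 1).1, hd, ?_⟩
  have hb : η.form p (1 : ℂ) ≠ 0 := by
    intro h0
    apply cross_map_ne_zero (hf.2 p)
    rw [hd, h0]
    ext i
    fin_cases i <;> simp [cross_apply]
  rw [gaussMap, hd]
  simpa using normalize_cross_weierstrassMap (g := g p) hb

variable [IsManifold 𝓘(ℂ, ℂ) ω M] [T2Space M]

/-- The second fundamental form is the real part of the Hopf differential. At the poles of the
Gauss map `g` this holds by continuity in a chart. -/
theorem HasWeierstrassData.inner_diff_gaussMap {f : M → R3} (hf : IsConformalImmersion f)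
    {g : M → ℂ} {q : HolomorphicQuadraticDifferential M} (hW : HasWeierstrassData f g q) (p : M)
    (v w : ℂ) :
    inner ℝ (diff (gaussMap f) p v) (diff f p w) = -(q.form p (1 : ℂ) * v * w).re := by
  have hgen : ∀ᶠ x in codiscrete M, ∀ v w : ℂ,
      inner ℝ (diff (gaussMap f) x v) (diff f x w) = -(q.form x (1 : ℂ) * v * w).re := by
    filter_upwards [eventually_codiscrete_nhds hW.1.eventually_isHolomorphicAt] with x hx v w
    obtain ⟨b, hb1, hb2, -⟩ := hW.exists_coeff hf hx.self_of_nhds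
    have hn : HasFDerivAt (fun z => gaussVec ((g ∘ (chartAt ℂ x).symm) z)) (diff (gaussMap f) x)
        (chartAt ℂ x x) := by
      refine (hasMFDerivAt_iff_chart.1 (hf.hasMFDerivAt_gaussMap x)).congr_of_eventuallyEq ?_
      filter_upwards [eventually_nhds_chart hx] with z hz
      obtain ⟨-, -, -, h⟩ := hW.exists_coeff hf hz
      exact h.symm
    have h := inner_fderiv_gaussVec hx.self_of_nhds.hasDerivAt hn v (b * w)
    rw [Function.comp_apply, (chartAt ℂ x).left_inv (mem_chart_source ℂ x)] at h
    rw [hb2, ContinuousLinearMap.comp_apply, ContinuousLinearMap.mul_apply', h, hb1]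
    have : 2 * b * cdiff g x 1 * v * w = ((2 : ℝ) : ℂ) * (cdiff g x 1 * v * (b * w)) := by
      push_cast; ring
    rw [this, re_ofReal_mul]
    ring
  have hpt := mem_chart_target ℂ p
  have hn := hf.contDiffAt_gaussMap_chart p hpt
  have hn1 : ContDiffAt ℝ 0 (fderiv ℝ (gaussMap f ∘ (chartAt ℂ p).symm)) (chartAt ℂ p p) :=
    hn.fderiv_right (by norm_num)
  have hf1 : ContDiffAt ℝ 0 (fderiv ℝ (f ∘ (chartAt ℂ p).symm)) (chartAt ℂ p p) :=
    (hf.contDiffAt_chart p hpt).fderiv_right (by norm_cast)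
  have key := eq_of_eventually_nhdsNE
    (u := fun z => inner ℝ (fderiv ℝ (gaussMap f ∘ (chartAt ℂ p).symm) z v)
      (fderiv ℝ (f ∘ (chartAt ℂ p).symm) z w))
    (v := fun z => -(q.coeff p z * v * w).re)
    ((hn1.continuousAt.clm_apply continuousAt_const).inner
      (hf1.continuousAt.clm_apply continuousAt_const))
    (continuous_re.continuousAt.comp
      (((q.analyticAt_coeff p).continuousAt.mul_const v).mul_const w)).neg ?_
  · have h1 : fderiv ℝ (gaussMap f ∘ (chartAt ℂ p).symm) (chartAt ℂ p p) = diff (gaussMap f) p :=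
      (hasMFDerivAt_iff_chart.1 (hf.hasMFDerivAt_gaussMap p)).fderiv
    have h2 : fderiv ℝ (f ∘ (chartAt ℂ p).symm) (chartAt ℂ p p) = diff f p :=
      (hasMFDerivAt_iff_chart.1 (hf.hasMFDerivAt p)).fderiv
    simpa only [h1, h2, q.coeff_self] using key
  · filter_upwards [(eventually_nhdsNE_iff_chart p).1 (eventually_codiscrete_iff.1 hgen p),
      eventually_mem_chart_target p] with z hz hzt
    rw [(hf.hasFDerivAt_chart p hzt).fderiv,
      (hasFDerivAt_comp_chart_symm p hzt (hf.hasMFDerivAt_gaussMap _)).fderiv]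
    simp only [ContinuousLinearMap.comp_apply, ContinuousLinearMap.mul_apply']
    rw [hz, q.coeff_eq]
    congr 2
    ring

/-- The shape operator of a surface with Weierstrass data `(g, q)` is conjugate-linear, with
coefficient the Hopf differential divided by the conformal factor. -/
theorem HasWeierstrassData.exists_shapeOperator_eq {f : M → R3} (hf : IsConformalImmersion f)
    {g : M → ℂ} {q : HolomorphicQuadraticDifferential M} (hW : HasWeierstrassData f g q) (p : M) :
    ∃ lam : ℝ, ∀ v : ℂ,
      shapeOperator f p v = lam * (starRingEnd ℂ) (q.form p (1 : ℂ) * v) := by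
  obtain ⟨lam, hpos, h⟩ := exists_inner_map_eq (hf.2 p)
  refine ⟨lam⁻¹, fun v => ?_⟩
  have key : ∀ w : ℂ, lam * inner ℝ (shapeOperator f p v) w = (q.form p (1 : ℂ) * v * w).re := by
    intro w
    rw [← h, hf.diff_shapeOperator, inner_neg_left, hW.inner_diff_gaussMap hf, neg_neg]
  have h1 := key 1
  have h2 := key I
  simp only [Complex.inner] at h1 h2
  simp at h1 h2
  apply Complex.ext
  · simp
    field_simp
    linarith
  · simp
    field_simp
    linarith

/-- Off a discrete set, the Hopf differential of a non-flat surface does not vanish. -/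
theorem HasWeierstrassData.eventually_form_ne_zero [ConnectedSpace M] {f : M → R3}
    (hf : IsConformalImmersion f) {g : M → ℂ} {q : HolomorphicQuadraticDifferential M}
    (hW : HasWeierstrassData f g q) (hflat : ¬ IsFlat f) :
    ∀ᶠ x in codiscrete M, q.form x (1 : ℂ) ≠ 0 := by
  refine q.eventually_eq_zero_or_ne.resolve_left fun h => hflat fun p => ?_
  have h0 : q.form p (1 : ℂ) = 0 := by
    rw [← q.coeff_self]
    refine eq_of_eventually_nhdsNE (v := fun _ => 0) (q.analyticAt_coeff p).continuousAt
      continuousAt_const ?_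
    filter_upwards [(eventually_nhdsNE_iff_chart p).1 (eventually_codiscrete_iff.1 h p)] with z hz
    rw [q.coeff_eq, hz, mul_zero]
  obtain ⟨lam, hlam⟩ := hW.exists_shapeOperator_eq hf p
  have hA : shapeOperator f p = 0 := by
    ext1 v
    rw [hlam, h0]
    simp
  rw [hA, LinearMap.det_zero]
  simp

end WeierstrassData

/-! ### Darboux pairs and the Riccati equation -/

section DarbouxPairs

open Complex

variable {M : Type*} [TopologicalSpace M] [ChartedSpace ℂ M] {f fh : M → R3} {g gh : M → ℂ}
  {q qh : HolomorphicQuadraticDifferential M}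

/-- The normals of two surfaces touching a common oriented sphere differ by a multiple of the
chord; the multiple is the curvature of the sphere, and vanishes for planes. -/
theorem OrientedSphere.Touches.gaussMap_sub {S : OrientedSphere} {p : M} (h : S.Touches f p)
    (hh : S.Touches fh p) : gaussMap f p - gaussMap fh p = S.a • (fh p - f p) ∧
      (S.a = 0 → inner ℝ (gaussMap f p) (fh p - f p) = 0) := by
  obtain ⟨h1, h2⟩ := h
  obtain ⟨h3, h4⟩ := hh
  refine ⟨?_, fun ha => ?_⟩
  · rw [← h2, ← h4, OrientedSphere.normal, OrientedSphere.normal, smul_sub]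
    abel
  · have h5 : S.a * ‖f p‖ ^ 2 - 2 * inner ℝ S.v (f p) + S.b = 0 := h1
    have h6 : S.a * ‖fh p‖ ^ 2 - 2 * inner ℝ S.v (fh p) + S.b = 0 := h3
    rw [← h2, OrientedSphere.normal, ha, zero_smul, sub_zero, inner_sub_right]
    rw [ha] at h5 h6
    linarith

theorem exists_sphere_touching {p : M} (hn : ‖gaussMap f p‖ = 1) (hnh : ‖gaussMap fh p‖ = 1)
    {a : ℝ} (ha : a ≠ 0) (h : gaussMap f p - gaussMap fh p = a • (fh p - f p)) :
    ∃ S : OrientedSphere, S.Touches f p ∧ S.Touches fh p := by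
  set n := gaussMap f p with hn_def
  have hnn : inner ℝ n n = (1 : ℝ) := by rw [real_inner_self_eq_norm_sq, hn, one_pow]
  have hfh : fh p = f p + a⁻¹ • (n - gaussMap fh p) := by
    rw [h, inv_smul_smul₀ ha]; abel
  have hv : ‖n + a • f p‖ ^ 2 = 1 + 2 * a * inner ℝ n (f p) + a ^ 2 * ‖f p‖ ^ 2 := by
    rw [norm_add_sq_real, hn, norm_smul, real_inner_smul_right, mul_pow, Real.norm_eq_abs, sq_abs]
    ring
  have hvf : inner ℝ (n + a • f p) (f p) = inner ℝ n (f p) + a * ‖f p‖ ^ 2 := by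
    rw [inner_add_left, real_inner_smul_left, real_inner_self_eq_norm_sq]
  refine ⟨⟨a, n + a • f p, 2 * inner ℝ n (f p) + a * ‖f p‖ ^ 2, by rw [hv]; ring⟩,
    ⟨?_, ?_⟩, ?_, ?_⟩
  · change a * ‖f p‖ ^ 2 - 2 * inner ℝ (n + a • f p) (f p) +
      (2 * inner ℝ n (f p) + a * ‖f p‖ ^ 2) = 0
    rw [hvf]
    ring
  · simp [OrientedSphere.normal, hn_def]
  · change a * ‖fh p‖ ^ 2 - 2 * inner ℝ (n + a • f p) (fh p) +
      (2 * inner ℝ n (f p) + a * ‖f p‖ ^ 2) = 0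
    set m := gaussMap fh p
    have hmm : inner ℝ m m = (1 : ℝ) := by rw [real_inner_self_eq_norm_sq, hnh, one_pow]
    rw [hfh, ← real_inner_self_eq_norm_sq, ← real_inner_self_eq_norm_sq]
    simp only [inner_add_left, inner_add_right, real_inner_smul_left, real_inner_smul_right,
      inner_sub_left, inner_sub_right, hnn, hmm, real_inner_comm n m, real_inner_comm n (f p),
      real_inner_comm m (f p)]
    field_simp
    ring
  · have h1 : a • fh p = a • f p + (n - gaussMap fh p) := by
      rw [h, ← smul_add]; congr 1; abel
    change n + a • f p - a • fh p = _
    rw [h1, add_comm n, add_sub_add_left_eq_sub, sub_sub_cancel]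

theorem diff_add_const (f : M → R3) (c : R3) : diff (fun p => f p + c) = diff f := by
  funext p
  -- A translation also preserves points of non-differentiability, where both sides are `0`.
  by_cases h : MDifferentiableAt 𝓘(ℝ, ℂ) 𝓘(ℝ, R3) f p
  · have h1 := (hasMFDerivAt_iff_chart.1 h.hasMFDerivAt).add_const c
    exact (hasMFDerivAt_iff_chart (h := fun p => f p + c).2 h1).mfderiv
  · have h2 : ¬ MDifferentiableAt 𝓘(ℝ, ℂ) 𝓘(ℝ, R3) (fun p => f p + c) p := by
      intro h3
      apply h
      have h1 := (hasMFDerivAt_iff_chart.1 h3.hasMFDerivAt).add_const (-c)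
      have h4 := (hasMFDerivAt_iff_chart (h := fun p => f p + c + -c).2 h1).mdifferentiableAt
      simpa using h4
    rw [diff, diff, mfderiv_zero_of_not_mdifferentiableAt h,
      mfderiv_zero_of_not_mdifferentiableAt h2]
    rfl

theorem IsConformalImmersion.add_const (hf : IsConformalImmersion f) (c : R3) :
    IsConformalImmersion fun p => f p + c := by
  refine ⟨?_, fun p => by rw [diff_add_const]; exact hf.2 p⟩
  have h : ContMDiff 𝓘(ℝ, R3) 𝓘(ℝ, R3) ∞ fun x : R3 => x + c :=
    (contDiff_id.add contDiff_const).contMDiff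
  exact h.comp hf.1

theorem HasWeierstrassData.add_const (hW : HasWeierstrassData f g q) (c : R3) :
    HasWeierstrassData (fun p => f p + c) g q := by
  refine ⟨hW.1, ?_⟩
  rw [diff_add_const]
  exact hW.2

theorem hasMFDerivAt_midVec {p : M} (hg : IsHolomorphicAt g p) (hgh : IsHolomorphicAt gh p)
    (h : g p ≠ gh p) :
    HasMFDerivAt 𝓘(ℝ, ℂ) 𝓘(ℝ, R3) (fun x => midVec (g x) (gh x)) p
      ((weierstrassMap (gh p)).comp
          (ContinuousLinearMap.mul ℝ ℂ (cdiff g p 1 / (gh p - g p) ^ 2)) -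
        (weierstrassMap (g p)).comp
          (ContinuousLinearMap.mul ℝ ℂ (cdiff gh p 1 / (gh p - g p) ^ 2))) := by
  rw [hasMFDerivAt_iff_chart]
  have hp := (chartAt ℂ p).left_inv (mem_chart_source ℂ p)
  have h1 := hasFDerivAt_midVec hg.hasDerivAt hgh.hasDerivAt (by simpa [hp] using h)
  simp only [Function.comp_apply, hp] at h1
  exact h1

variable [IsManifold 𝓘(ℂ, ℂ) ω M]

/-- The Riccati equation extends over the points where it is not known: it is an identity between
continuous functions in a chart. -/
theorem holomorphicRiccati_of_eventually (hg : IsMeromorphicFunction g)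
    (hgh : IsMeromorphicFunction gh) {t : ℝ}
    (h : ∀ᶠ x in codiscrete M, cdiff g x 1 * cdiff gh x 1 =
      t * (gh x - g x) ^ 2 * q.form x (1 : ℂ)) : HolomorphicRiccati t g gh q := by
  intro p hp hph v
  have ha := hg.analyticAt hp
  have hah := hgh.analyticAt hph
  have hleft := (chartAt ℂ p).left_inv (mem_chart_source ℂ p)
  have key := eq_of_eventually_nhdsNE
    (u := fun z => deriv (g ∘ (chartAt ℂ p).symm) z * deriv (gh ∘ (chartAt ℂ p).symm) z)
    (v := fun z => t * ((gh ∘ (chartAt ℂ p).symm) z - (g ∘ (chartAt ℂ p).symm) z) ^ 2 *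
      q.coeff p z)
    (ha.deriv.continuousAt.mul hah.deriv.continuousAt)
    ((continuousAt_const.mul ((hah.continuousAt.sub ha.continuousAt).pow 2)).mul
      (q.analyticAt_coeff p).continuousAt) ?_
  · simp only [hp.hasDerivAt.deriv, hph.hasDerivAt.deriv, q.coeff_self, Function.comp_apply,
      hleft] at key
    rw [cdiff_apply g, cdiff_apply gh, q.form_eq]
    linear_combination v ^ 2 * key
  · have hall := h.and (hg.eventually_isHolomorphicAt.and hgh.eventually_isHolomorphicAt)
    filter_upwards [(eventually_nhdsNE_iff_chart p).1 (eventually_codiscrete_iff.1 hall p),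
      eventually_mem_chart_target p] with z hz hzt
    obtain ⟨h0, h1, h2⟩ := hz
    rw [(hasDerivAt_comp_chart_symm p hzt h1).deriv, (hasDerivAt_comp_chart_symm p hzt h2).deriv,
      cdiff_apply g, cdiff_apply gh, q.coeff_eq]
    simp only [Function.comp_apply]
    linear_combination coordVec p z ^ 2 * h0

variable [T2Space M]

/-- Surfaces with the same Hopf differential whose difference is a constant multiple of `midVec`
form a Darboux pair: they satisfy `t |f̂ - f|² (n - n̂) = f̂ - f`, which is a closed condition and
hence holds at the poles as well. -/
theorem isDarbouxPair_of_sub_eq (hf : IsConformalImmersion f)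
    (hfh : IsConformalImmersion fh) (hW : HasWeierstrassData f g q)
    (hWh : HasWeierstrassData fh gh q) {t : ℝ} (ht : t ≠ 0)
    (h : ∀ᶠ x in codiscrete M,
      g x ≠ gh x ∧ fh x - f x = (2 * t)⁻¹ • midVec (g x) (gh x)) : IsDarbouxPair f fh := by
  have hcont : Continuous fun x => fh x - f x := hfh.1.continuous.sub hf.1.continuous
  have hhol := hW.1.eventually_isHolomorphicAt.and hWh.1.eventually_isHolomorphicAt
  have hgen : ∀ᶠ x in codiscrete M, (4 * t ^ 2)⁻¹ ≤ ‖fh x - f x‖ ^ 2 ∧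
      (t * ‖fh x - f x‖ ^ 2) • (gaussMap f x - gaussMap fh x) = fh x - f x := by
    filter_upwards [h, hhol] with x hx hx'
    obtain ⟨-, -, -, hn⟩ := hW.exists_coeff hf hx'.1
    obtain ⟨-, -, -, hnh⟩ := hWh.exists_coeff hfh hx'.2
    have hmid := one_le_norm_midVec_sq hx.1
    have hnorm : ‖fh x - f x‖ ^ 2 = (4 * t ^ 2)⁻¹ * ‖midVec (g x) (gh x)‖ ^ 2 := by
      rw [hx.2, norm_smul, mul_pow, Real.norm_eq_abs, sq_abs]
      ring
    refine ⟨?_, ?_⟩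
    · rw [hnorm]
      exact le_mul_of_one_le_right (by positivity) hmid
    · rw [hnorm, hn, hnh, gaussVec_sub_gaussVec hx.1, hx.2, smul_smul]
      congr 1
      have := norm_ne_zero_iff.2 (midVec_ne_zero hx.1)
      field_simp
      ring
  have hdense : ∀ p : M, (4 * t ^ 2)⁻¹ ≤ ‖fh p - f p‖ ^ 2 ∧
      (t * ‖fh p - f p‖ ^ 2) • (gaussMap f p - gaussMap fh p) = fh p - f p := by
    intro p
    have := nhdsNE_neBot p
    have hp := eventually_codiscrete_iff.1 hgen p
    refine ⟨?_, ?_⟩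
    · exact ge_of_tendsto ((hcont.norm.pow 2).continuousAt.tendsto.mono_left nhdsWithin_le_nhds)
        (hp.mono fun x hx => hx.1)
    · refine tendsto_nhds_unique_of_eventuallyEq (l := 𝓝[≠] p) ?_ ?_ (hp.mono fun x hx => hx.2)
      · exact (((hcont.norm.pow 2).const_mul t).smul (hf.continuous_gaussMap.sub
          hfh.continuous_gaussMap)).continuousAt.tendsto.mono_left nhdsWithin_le_nhds
      · exact hcont.continuousAt.tendsto.mono_left nhdsWithin_le_nhds
  have hpos : ∀ p, 0 < ‖fh p - f p‖ ^ 2 := fun p =>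
    lt_of_lt_of_le (by positivity) (hdense p).1
  refine ⟨⟨fun p hp => ?_, fun p => ?_, fun p => ?_⟩, ?_⟩
  · have := hpos p
    rw [hp, sub_self] at this
    norm_num at this
  · have hne : t * ‖fh p - f p‖ ^ 2 ≠ 0 := mul_ne_zero ht (hpos p).ne'
    refine exists_sphere_touching (hf.norm_gaussMap p) (hfh.norm_gaussMap p) (inv_ne_zero hne) ?_
    nth_rewrite 2 [← (hdense p).2]
    rw [inv_smul_smul₀ hne]
  · obtain ⟨lam, hlam⟩ := hW.exists_shapeOperator_eq hf p
    obtain ⟨lamh, hlamh⟩ := hWh.exists_shapeOperator_eq hfh p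
    refine LinearMap.ext fun v => ?_
    change shapeOperator f p (shapeOperator fh p v) = shapeOperator fh p (shapeOperator f p v)
    rw [hlam, hlamh, hlamh, hlam]
    simp
    ring
  · choose lam hlam h1 using fun p => exists_inner_map_eq (hf.2 p)
    choose lamh hlamh h2 using fun p => exists_inner_map_eq (hfh.2 p)
    refine ⟨fun p => lamh p / lam p, fun p => ⟨div_pos (hlamh p) (hlam p), fun v w => ?_⟩⟩
    rw [h1, h2, ← mul_assoc, div_mul_cancel₀ _ (hlam p).ne']

variable [ConnectedSpace M]

/-- For a Ribaucour pair of surfaces with Weierstrass data the stereographic projections of the two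
Gauss maps differ off a discrete set: where the Gauss maps agree on an open set, the touching
spheres are planes, and the chord is tangent to both surfaces, so that the Gauss maps are
singular. -/
theorem IsRibaucourPair.eventually_ne (hf : IsConformalImmersion f) (hfh : IsConformalImmersion fh)
    (hW : HasWeierstrassData f g q) (hWh : HasWeierstrassData fh gh qh) (hflat : ¬ IsFlat f)
    (hR : IsRibaucourPair f fh) : ∀ᶠ x in codiscrete M, g x ≠ gh x := by
  refine (hW.1.eventually_eq_or_ne hWh.1).resolve_left fun heq => ?_
  obtain ⟨p₀⟩ := (inferInstance : Nonempty M)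
  have hall := (eventually_codiscrete_nhds (heq.and
    (hW.1.eventually_isHolomorphicAt.and hWh.1.eventually_isHolomorphicAt))).and
      (hW.eventually_form_ne_zero hf hflat)
  have := nhdsNE_neBot p₀
  obtain ⟨x, hx, hqx⟩ := (eventually_codiscrete_iff.1 hall p₀).exists
  obtain ⟨hx0, hx1, hx2⟩ := hx.self_of_nhds
  obtain ⟨b, hb1, hb2, -⟩ := hW.exists_coeff hf hx1
  obtain ⟨bh, -, hbh2, -⟩ := hWh.exists_coeff hfh hx2
  apply hqx
  rw [hb1]
  refine mul_eq_zero_of_right _ ?_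
  have hp := (chartAt ℂ x).left_inv (mem_chart_source ℂ x)
  refine deriv_eq_zero_of_inner_gaussVec hx1.hasDerivAt
    ((hasMFDerivAt_iff_chart.1 (hfh.hasMFDerivAt x)).sub
      (hasMFDerivAt_iff_chart.1 (hf.hasMFDerivAt x))) ?_ (fun v => ?_) ?_
  · simp only [Pi.sub_apply, Function.comp_apply, hp]
    exact sub_ne_zero.2 (hR.1 x).symm
  · simp only [Function.comp_apply, hp, sub_apply, hb2, hbh2, ← hx0, inner_sub_right,
      ContinuousLinearMap.comp_apply, inner_gaussVec_weierstrassMap, sub_zero]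
  · filter_upwards [eventually_nhds_chart hx] with z hz
    obtain ⟨hz0, hz1, hz2⟩ := hz
    obtain ⟨-, -, -, hn⟩ := hW.exists_coeff hf hz1
    obtain ⟨-, -, -, hnh⟩ := hWh.exists_coeff hfh hz2
    obtain ⟨S, hS, hSh⟩ := hR.2.1 ((chartAt ℂ x).symm z)
    obtain ⟨h1, h2⟩ := hS.gaussMap_sub hSh
    rw [hn, hnh, hz0, sub_self] at h1
    rw [hn] at h2
    exact h2 ((smul_eq_zero.1 h1.symm).resolve_right (sub_ne_zero.2 (hR.1 _).symm))

/-- The ratio of the chord of a Ribaucour pair to `midVec` is a constant `s`; the differential of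
the chord then yields both Weierstrass data, with `t = 1 / (2 s)`. -/
theorem IsRibaucourPair.exists_holomorphicRiccati (hf : IsConformalImmersion f)
    (hfh : IsConformalImmersion fh) (hW : HasWeierstrassData f g q)
    (hWh : HasWeierstrassData fh gh qh) (hflat : ¬ IsFlat f) (hR : IsRibaucourPair f fh) :
    ∃ t : ℝ, t ≠ 0 ∧ HolomorphicRiccati t g gh q ∧ qh = q := by
  have hall := eventually_codiscrete_nhds ((hR.eventually_ne hf hfh hW hWh hflat).and
    (hW.1.eventually_isHolomorphicAt.and hWh.1.eventually_isHolomorphicAt))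
  set S : M → ℝ := fun x => inner ℝ (fh x - f x) (midVec (g x) (gh x)) /
    ‖midVec (g x) (gh x)‖ ^ 2 with hS
  have hloc : ∀ᶠ x in codiscrete M, fh x - f x = S x • midVec (g x) (gh x) ∧
      q.form x (1 : ℂ) = 2 * (S x * (cdiff gh x 1 / (gh x - g x) ^ 2)) * cdiff g x 1 ∧
      qh.form x (1 : ℂ) = 2 * (S x * (cdiff g x 1 / (gh x - g x) ^ 2)) * cdiff gh x 1 ∧
      HasMFDerivAt 𝓘(ℝ, ℂ) 𝓘(ℝ, ℝ) S x (0 : ℂ →L[ℝ] ℝ) := by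
    filter_upwards [hall] with x hx
    obtain ⟨hx0, hx1, hx2⟩ := hx.self_of_nhds
    obtain ⟨b, hb1, hb2, -⟩ := hW.exists_coeff hf hx1
    obtain ⟨bh, hbh1, hbh2, -⟩ := hWh.exists_coeff hfh hx2
    have hp := (chartAt ℂ x).left_inv (mem_chart_source ℂ x)
    have hF := (hasMFDerivAt_iff_chart.1 (hfh.hasMFDerivAt x)).sub
      (hasMFDerivAt_iff_chart.1 (hf.hasMFDerivAt x))
    rw [hb2, hbh2] at hF
    obtain ⟨s, hs1, hs2, hs3, hs4, hs5⟩ := ratio_of_parallel hx1.hasDerivAt hx2.hasDerivAt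
      (by simpa only [Function.comp_apply, hp] using hx0)
      (b := b) (bh := bh) (by simpa only [Function.comp_apply, hp] using hF) (by
        filter_upwards [eventually_nhds_chart hx] with z hz
        obtain ⟨-, hz1, hz2⟩ := hz
        obtain ⟨-, -, -, hn⟩ := hW.exists_coeff hf hz1
        obtain ⟨-, -, -, hnh⟩ := hWh.exists_coeff hfh hz2
        obtain ⟨S, hS, hSh⟩ := hR.2.1 ((chartAt ℂ x).symm z)
        obtain ⟨h1, -⟩ := hS.gaussMap_sub hSh
        rw [hn, hnh] at h1
        exact ⟨S.a, h1⟩)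
    simp only [Pi.sub_apply, Function.comp_apply, hp] at hs1 hs2 hs3 hs4
    have hSx : S x = s := hs4
    rw [hSx]
    refine ⟨hs1, ?_, ?_, hasMFDerivAt_iff_chart.2 hs5⟩
    · rw [hb1, hs2]
    · rw [hbh1, hs3]
  obtain ⟨s, hs⟩ := eventually_codiscrete_eq_const (hloc.mono fun x hx => hx.2.2.2)
  have hs0 : s ≠ 0 := by
    rintro rfl
    obtain ⟨p₀⟩ := (inferInstance : Nonempty M)
    have := nhdsNE_neBot p₀
    obtain ⟨x, hx, hsx⟩ := (eventually_codiscrete_iff.1 (hloc.and hs) p₀).exists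
    have h1 := hx.1
    rw [hsx, zero_smul] at h1
    exact hR.1 x (sub_eq_zero.1 h1).symm
  refine ⟨(2 * s)⁻¹, inv_ne_zero (mul_ne_zero two_ne_zero hs0),
    holomorphicRiccati_of_eventually hW.1 hWh.1 ?_,
    HolomorphicQuadraticDifferential.eq_of_eventually ?_⟩
  · filter_upwards [hloc, hs, hall] with x hx hsx hx'
    have hne : gh x - g x ≠ 0 := sub_ne_zero.2 hx'.self_of_nhds.1.symm
    have hsc : (s : ℂ) ≠ 0 := ofReal_ne_zero.2 hs0
    rw [hx.2.1, hsx]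
    push_cast
    field_simp
  · filter_upwards [hloc] with x hx
    rw [hx.2.1, hx.2.2.1]
    ring

/-- The Riccati equation makes the difference of the two surfaces, up to an additive constant, a
constant multiple of `midVec`. -/
theorem HolomorphicRiccati.exists_sub_eq (hf : IsConformalImmersion f)
    (hfh : IsConformalImmersion fh) (hW : HasWeierstrassData f g q)
    (hWh : HasWeierstrassData fh gh q) (hflat : ¬ IsFlat f) {t : ℝ} (ht : t ≠ 0)
    (hRic : HolomorphicRiccati t g gh q) :
    ∃ c : R3, ∀ᶠ x in codiscrete M,
      g x ≠ gh x ∧ fh x + c - f x = (2 * t)⁻¹ • midVec (g x) (gh x) := by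
  have hhol := hW.1.eventually_isHolomorphicAt.and hWh.1.eventually_isHolomorphicAt
  have hq := hW.eventually_form_ne_zero hf hflat
  have hne : ∀ᶠ x in codiscrete M, g x ≠ gh x := by
    refine (hW.1.eventually_eq_or_ne hWh.1).resolve_left fun heq => ?_
    obtain ⟨p₀⟩ := (inferInstance : Nonempty M)
    have := nhdsNE_neBot p₀
    obtain ⟨x, ⟨hx, hx1, hx2⟩, hqx⟩ := (eventually_codiscrete_iff.1
      (((eventually_codiscrete_nhds heq).and hhol).and hq) p₀).exists
    have h1 : cdiff gh x 1 = cdiff g x 1 := by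
      refine (hx2.hasDerivAt.congr_of_eventuallyEq ?_).unique hx1.hasDerivAt
      filter_upwards [eventually_nhds_chart hx] with z hz using hz
    have h2 := hRic x hx1 hx2 1
    rw [h1, hx.self_of_nhds, sub_self] at h2
    obtain ⟨b, hb1, -⟩ := hW.exists_coeff hf hx1
    apply hqx
    rw [hb1]
    simp at h2
    rw [h2, mul_zero]
  have hder : ∀ᶠ x in codiscrete M, HasMFDerivAt 𝓘(ℝ, ℂ) 𝓘(ℝ, R3)
      (fun x => fh x - f x - (2 * t)⁻¹ • midVec (g x) (gh x)) x (0 : ℂ →L[ℝ] R3) := by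
    filter_upwards [hne, hhol, hq] with x hx hx' hqx
    obtain ⟨hx1, hx2⟩ := hx'
    obtain ⟨b, hb1, hb2, -⟩ := hW.exists_coeff hf hx1
    obtain ⟨bh, hbh1, hbh2, -⟩ := hWh.exists_coeff hfh hx2
    have hmid := hasMFDerivAt_midVec hx1 hx2 hx
    have h1 := (((hasMFDerivAt_iff_chart.1 (hfh.hasMFDerivAt x)).sub
      (hasMFDerivAt_iff_chart.1 (hf.hasMFDerivAt x))).sub
        ((hasMFDerivAt_iff_chart.1 hmid).const_smul (2 * t)⁻¹))
    rw [hasMFDerivAt_iff_chart]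
    refine h1.congr_fderiv ?_
    have hg0 : cdiff g x 1 ≠ 0 := fun h0 => hqx (by rw [hb1, h0, mul_zero])
    have hgh0 : cdiff gh x 1 ≠ 0 := fun h0 => hqx (by rw [hbh1, h0, mul_zero])
    have hd : gh x - g x ≠ 0 := sub_ne_zero.2 hx.symm
    have htc : (t : ℂ) ≠ 0 := ofReal_ne_zero.2 ht
    have h2 := hRic x hx1 hx2 1
    have hb : b = ((2 * t)⁻¹ : ℝ) * (cdiff gh x 1 / (gh x - g x) ^ 2) := by
      have h3 : cdiff gh x 1 = 2 * t * (gh x - g x) ^ 2 * b := by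
        refine mul_left_cancel₀ hg0 (h2.trans ?_)
        refine (congrArg (_ * ·) hb1).trans ?_
        ring
      rw [h3]
      push_cast
      field_simp
    have hbh : bh = ((2 * t)⁻¹ : ℝ) * (cdiff g x 1 / (gh x - g x) ^ 2) := by
      have h3 : cdiff g x 1 = 2 * t * (gh x - g x) ^ 2 * bh := by
        refine mul_right_cancel₀ hgh0 (h2.trans ?_)
        refine (congrArg (_ * ·) hbh1).trans ?_
        ring
      rw [h3]
      push_cast
      field_simp
    have hsm : ∀ (r : ℝ) (a c v : ℂ), weierstrassMap a ((r : ℂ) * c * v) =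
        r • weierstrassMap a (c * v) := fun r a c v => by
      rw [← map_smul, real_smul, mul_assoc]
    ext1 v
    simp only [hb2, hbh2, sub_apply, ContinuousLinearMap.comp_apply,
      ContinuousLinearMap.mul_apply', smul_apply, zero_apply, smul_sub]
    rw [hb, hbh, hsm, hsm, sub_self]
  obtain ⟨c, hc⟩ := eventually_codiscrete_eq_const hder
  refine ⟨-c, ?_⟩
  filter_upwards [hne, hc] with x hx hcx
  refine ⟨hx, ?_⟩
  rw [← hcx]
  abel

end DarbouxPairs

end MinimalDarboux

theorem corollary2 {M : Type*} [TopologicalSpace M] [T2Space M] [ConnectedSpace M]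
    [ChartedSpace ℂ M] [IsManifold 𝓘(ℂ, ℂ) ω M]
    (f fh : M → MinimalDarboux.R3)
    (hf : MinimalDarboux.IsConformalMinimalImmersion f)
    (hfh : MinimalDarboux.IsConformalMinimalImmersion fh)
    (hf_nonflat : ¬ MinimalDarboux.IsFlat f)
    (hfh_nonflat : ¬ MinimalDarboux.IsFlat fh)
    (g gh : M → ℂ)
    (q qh : MinimalDarboux.HolomorphicQuadraticDifferential M)
    (hW : MinimalDarboux.HasWeierstrassData f g q)
    (hWh : MinimalDarboux.HasWeierstrassData fh gh qh) :
    (∃ c : MinimalDarboux.R3, MinimalDarboux.IsDarbouxPair f (fun p => fh p + c)) ↔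
      ∃ t : ℝ, t ≠ 0 ∧ MinimalDarboux.HolomorphicRiccati t g gh q ∧ qh = q := by
  constructor
  · rintro ⟨c, hR, -⟩
    exact hR.exists_holomorphicRiccati hf.1 (hfh.1.add_const c) hW (hWh.add_const c) hf_nonflat
  · rintro ⟨t, ht, hRic, rfl⟩
    obtain ⟨c, hc⟩ := hRic.exists_sub_eq hf.1 hfh.1 hW hWh hf_nonflat ht
    exact ⟨c, MinimalDarboux.isDarbouxPair_of_sub_eq hf.1 (hfh.1.add_const c) hW
      (hWh.add_const c) ht hc⟩
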